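/- Setting. Let $A$ be a real $r\times r$ matrix, $R$ a symmetric positive definite $r\times r$ matrix, $C$ a real $r'\times r$ matrix, $\Sigma$ a symmetric positive definite $r'\times r'$ matrix, and $S:=C'\Sigma^{-1}C$. Assume that $(A,C)$ is observable, i.e. the matrix with blocks $C,CA,\dots,CA^{r-1}$ has rank $r$. Let $\|\cdot\|_2$ be the spectral norm, $\le$ the Loewner order, and $\mathbb S_r^+$ the set of symmetric positive semi-definite $r\times r$ matrices. Let $\mathrm{Ricc}(Q)=AQ+QA'-QSQ+R$, let $\phi_t(Q)\in\mathbb S_r^+$, $t\ge 0$, be the flow of $\partial_t\phi_t(Q)=\mathrm{Ricc}(\phi_t(Q))$, $\phi_0(Q)=Q$, on $\mathbb S_r^+$, and let $P$ be the positive definite solution of $\mathrm{Ricc}(P)=0$. Let $E_t(Q)$ solve $\partial_tE_t(Q)=(A-\phi_t(Q)S)E_t(Q)$, $E_0(Q)=Id$. Call $\nu>0$ a contraction rate of $(A,R,S)$ if, for some non-decreasing function $\kappa_E:[0,\infty)\to\mathbb R$, $\|E_t(Q)\|_2\le\kappa_E(\|Q\|_2)\,e^{-2\nu t}$ for all $t\ge0$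 and $Q\in\mathbb S_r^+$. Let $\Pi$ be a set of continuous maps $\pi:\mathbb S_r^+\to\mathbb S_r^+$ and, for $\delta>0$, let $B(\delta)=\{\pi\in\Pi:\ \sup_{Q\in\mathbb S_r^+}\|\pi(Q)-Q\|_2\le\delta\}$. Let $(A_\pi,R_\pi,S_\pi)_{\pi\in\Pi}$ be real $r\times r$ matrices satisfying $(H)_2$: for all $\epsilon\in(0,1]$ and $\alpha\in(0,1)$ there is $\delta>0$ such that for all $\pi\in B(\delta)$: $\ \alpha S\le S_\pi\le\alpha^{-1}S$, $\ \alpha R\le R_\pi\le\alpha^{-1}R$ and $\|A-A_\pi\|_2\le\epsilon$. Let $\mathrm{Ricc}_\pi(Q)=A_\pi Q+QA_\pi'-QS_\pi Q+R_\pi$, let $\phi_{\pi,t}$ be its flow on $\mathbb S_r^+$, let $P_\pi$ be the positive definite solution of $\mathrm{Ricc}_\pi(P_\pi)=0$, and let $\gamma(\pi)=\|A_\pi-A\|_2+\|R_\pi-R\|_2+\|S_\pi-S\|_2$. Theorem 2.6. The flow $\phi_t$ on $[0,\infty)$ and the matrix $P$ exist and are unique, and $(A,R,S)$ has a contraction rate.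 For every contraction rate $\nu$ of $(A,R,S)$ there are finite functions $\chi_1(\cdot)$ and $\chi_2(\cdot,\cdot)$, depending only on $(A,R,S)$ and $\nu$, such that for all $\Pi$ and $(A_\pi,R_\pi,S_\pi)_{\pi\in\Pi}$ satisfying $(H)_2$ there is $\delta>0$ for which the following holds for every $\pi\in B(\delta)$. 1. The flow $\phi_{\pi,t}$ exists and is unique on $[0,\infty)$, and for all $t\ge0$ and $Q\in\mathbb S_r^+$, $$\|\phi_{\pi,t}(Q)-\phi_t(Q)\|_2\le\left[\chi_1(\delta)+e^{-4t\nu}\chi_2(\delta,\|Q\|_2)\right]\gamma(\pi).$$ 2. The matrix $P_\pi$ exists and is unique, and $\|P_\pi-P\|_2\le\chi_1(\delta)\,\gamma(\pi)$. 3. Let $\mathrm{Ricc}^\pi(Q)=[A-\pi(Q)S]Q+Q[A-\pi(Q)S]'+R+\pi(Q)S\pi(Q)$, and suppose that $\pi$ satisfies $(H)_0$: for all $Q\in\mathbb S_r^+$, $\ \mathrm{Ricc}^\pi(Q)=\mathrm{Ricc}(Q)+B_0+B_1Q+QB_1'+QB_2Q+\mathcal R(Q)$, where $B_0,B_1,B_2$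 are symmetric, $B_2\le S$, $\mathcal R(Q)$ is symmetric and $\varpi:=\sup_{Q\in\mathbb S_r^+}\|\mathcal R(Q)\|_2<\infty$, and that $A_\pi=A+B_1$, $R_\pi=R+B_0+\varpi\,Id$, $S_\pi=S-B_2$. Then for every $Q\in\mathbb S_r^+$, every $\mathbb S_r^+$-valued solution $\phi^\pi_t(Q)$, $t\in[0,\infty)$, of $\partial_t\phi^\pi_t(Q)=\mathrm{Ricc}^\pi(\phi^\pi_t(Q))$, $\phi^\pi_0(Q)=Q$, satisfies for all $t\ge0$ $$\|\phi^\pi_t(Q)-\phi_t(Q)\|_2\le\left[\chi_1(\delta)+e^{-4t\nu}\chi_2(\delta,\|Q\|_2)\right]\gamma(\pi).$$ -/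

import Mathlib

open scoped Matrix Matrix.Norms.L2Operator

/-- The cone of real symmetric positive semi-definite `r × r` matrices. Since the L2 operator norm
is in scope, `‖M‖` is the spectral norm of a matrix `M` everywhere below. -/
abbrev PSDMat (r : ℕ) : Type := {Q : Matrix (Fin r) (Fin r) ℝ // Q.PosSemidef}

/-- Kalman's observability matrix: the blocks `C`, `C A`, …, `C A ^ (r - 1)` stacked. -/
def observabilityMatrix {r m : ℕ} (A : Matrix (Fin r) (Fin r) ℝ) (C : Matrix (Fin m) (Fin r) ℝ) :
    Matrix (Fin r × Fin m) (Fin r) ℝ :=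
  Matrix.of fun ki j => (C * A ^ (ki.1 : ℕ)) ki.2 j

/-- The pair `(A, C)` is observable. -/
def IsObservablePair {r m : ℕ} (A : Matrix (Fin r) (Fin r) ℝ) (C : Matrix (Fin m) (Fin r) ℝ) :
    Prop :=
  (observabilityMatrix A C).rank = r

/-- The Riccati drift `A Q + Q A' - Q S Q + R`. -/
def ricc {r : ℕ} (A R S Q : Matrix (Fin r) (Fin r) ℝ) : Matrix (Fin r) (Fin r) ℝ :=
  A * Q + Q * Aᵀ - Q * S * Q + R

/-- The drift `[A - π(Q) S] Q + Q [A - π(Q) S]' + R + π(Q) S π(Q)` of the `π`-perturbed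
Riccati equation. -/
def riccMap {r : ℕ} (A R S : Matrix (Fin r) (Fin r) ℝ) (π : PSDMat r → PSDMat r) (Q : PSDMat r) :
    Matrix (Fin r) (Fin r) ℝ :=
  (A - (π Q).1 * S) * Q.1 + Q.1 * (A - (π Q).1 * S)ᵀ + R + (π Q).1 * S * (π Q).1

/-- `p` is a solution on `[0, ∞)` of the matrix differential equation `p' = F(p)`, `p(0) = Q`,
with values in the cone of positive semi-definite matrices (values of `p` at negative times
play no role). -/
def IsRiccatiSolution {r : ℕ} (F : PSDMat r → Matrix (Fin r) (Fin r) ℝ) (Q : PSDMat r)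
    (p : ℝ → PSDMat r) : Prop :=
  p 0 = Q ∧ ∀ t : ℝ, 0 ≤ t →
    HasDerivWithinAt (fun s : ℝ => (p s).1) (F (p t)) (Set.Ici 0) t

/-- Global existence and uniqueness of solutions on `[0, ∞)` from every initial matrix. -/
def RiccatiWellPosed {r : ℕ} (F : PSDMat r → Matrix (Fin r) (Fin r) ℝ) : Prop :=
  ∀ Q : PSDMat r, ∃ p : ℝ → PSDMat r, IsRiccatiSolution F Q p ∧
    ∀ q : ℝ → PSDMat r, IsRiccatiSolution F Q q → ∀ t : ℝ, 0 ≤ t → q t = p t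

open Classical in
/-- The flow `(t, Q) ↦ φ_t(Q)` of `p' = F(p)`. It is meaningful at times `t ≥ 0` when the equation
is well posed. -/
noncomputable def riccatiFlow {r : ℕ} (F : PSDMat r → Matrix (Fin r) (Fin r) ℝ) (t : ℝ)
    (Q : PSDMat r) : PSDMat r :=
  if h : ∃ p : ℝ → PSDMat r, IsRiccatiSolution F Q p then h.choose t else Q

/-- The semigroup of the Riccati equation with matrices `(A, R, S)`. -/
noncomputable def phi {r : ℕ} (A R S : Matrix (Fin r) (Fin r) ℝ) (t : ℝ) (Q : PSDMat r) :
    PSDMat r :=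
  riccatiFlow (fun X => ricc A R S X.1) t Q

/-- `P` is a positive definite solution of the algebraic Riccati equation. -/
def IsRiccatiFixedPoint {r : ℕ} (A R S P : Matrix (Fin r) (Fin r) ℝ) : Prop :=
  P.PosDef ∧ ricc A R S P = 0

/-- `E` is the transition matrix `t ↦ E_t(Q)` on `[0, ∞)` of the time-varying linear drift
`A - φ_t(Q) S`. -/
def IsTransitionMatrix {r : ℕ} (A R S : Matrix (Fin r) (Fin r) ℝ) (Q : PSDMat r)
    (E : ℝ → Matrix (Fin r) (Fin r) ℝ) : Prop :=
  E 0 = 1 ∧ ∀ t : ℝ, 0 ≤ t →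
    HasDerivWithinAt E ((A - (phi A R S t Q).1 * S) * E t) (Set.Ici 0) t

/-- `ν > 0` is a contraction rate of the model `(A, R, S)`:
`‖E_t(Q)‖ ≤ κ(‖Q‖) exp(-2 ν t)` for all `t ≥ 0` and all `Q`, with a finite non-decreasing `κ`. -/
def IsContractionRate {r : ℕ} (A R S : Matrix (Fin r) (Fin r) ℝ) (ν : ℝ) : Prop :=
  0 < ν ∧ ∃ κ : ℝ → ℝ, MonotoneOn κ (Set.Ici 0) ∧
    ∀ Q : PSDMat r, ∃ E : ℝ → Matrix (Fin r) (Fin r) ℝ, IsTransitionMatrix A R S Q E ∧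
      ∀ t : ℝ, 0 ≤ t → ‖E t‖ ≤ κ ‖Q.1‖ * Real.exp (-2 * ν * t)

/-- The elements of the set `M` of continuous mappings at uniform distance at most `δ` from the
identity. -/
def idBall {r : ℕ} (M : Set C(PSDMat r, PSDMat r)) (δ : ℝ) : Set C(PSDMat r, PSDMat r) :=
  {π | π ∈ M ∧ ∀ Q : PSDMat r, ‖(π Q).1 - Q.1‖ ≤ δ}

/-- The continuity condition on the perturbed matrices `(A_π, R_π, S_π)`; matrix inequalities are
in the Loewner order. -/
def ContinuityCondition {r : ℕ} (A R S : Matrix (Fin r) (Fin r) ℝ)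
    (M : Set C(PSDMat r, PSDMat r))
    (Ap Rp Sp : C(PSDMat r, PSDMat r) → Matrix (Fin r) (Fin r) ℝ) : Prop :=
  ∀ ε α : ℝ, 0 < ε → ε ≤ 1 → 0 < α → α < 1 → ∃ δ : ℝ, 0 < δ ∧ ∀ π ∈ idBall M δ,
    (Sp π - α • S).PosSemidef ∧ (α⁻¹ • S - Sp π).PosSemidef ∧
    (Rp π - α • R).PosSemidef ∧ (α⁻¹ • R - Rp π).PosSemidef ∧
    ‖A - Ap π‖ ≤ ε

/-- The size `γ = ‖A₁ - A‖ + ‖R₁ - R‖ + ‖S₁ - S‖` of a perturbation `(A₁, R₁, S₁)` of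
`(A, R, S)`. -/
noncomputable def gammaDist {r : ℕ} (A R S A₁ R₁ S₁ : Matrix (Fin r) (Fin r) ℝ) : ℝ :=
  ‖A₁ - A‖ + ‖R₁ - R‖ + ‖S₁ - S‖

/-- The structural condition on the `π`-perturbed Riccati drift: it is the nominal drift plus
`Γ(Q) = B₀ + B₁ Q + Q B₁' + Q B₂ Q + 𝓡(Q)`, with symmetric `B₀, B₁, B₂`, with `B₂ ≤ S`, and with
a symmetric remainder of finite supremum norm `ϖ`; and `(A₁, R₁, S₁)` are the matrices
`(A + B₁, R + B₀ + ϖ Id, S - B₂)` attached to this decomposition. -/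
def QuadraticPerturbation {r : ℕ} (A R S : Matrix (Fin r) (Fin r) ℝ)
    (π : PSDMat r → PSDMat r) (A₁ R₁ S₁ : Matrix (Fin r) (Fin r) ℝ) : Prop :=
  ∃ (B₀ B₁ B₂ : Matrix (Fin r) (Fin r) ℝ) (Rem : PSDMat r → Matrix (Fin r) (Fin r) ℝ) (ϖ : ℝ),
    B₀.IsSymm ∧ B₁.IsSymm ∧ B₂.IsSymm ∧ (S - B₂).PosSemidef ∧
    (∀ Q : PSDMat r, (Rem Q).IsSymm) ∧
    IsLUB (Set.range fun Q : PSDMat r => ‖Rem Q‖) ϖ ∧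
    (∀ Q : PSDMat r, riccMap A R S π Q =
      ricc A R S Q.1 + (B₀ + B₁ * Q.1 + Q.1 * B₁ᵀ + Q.1 * B₂ * Q.1 + Rem Q)) ∧
    A₁ = A + B₁ ∧ R₁ = R + B₀ + ϖ • (1 : Matrix (Fin r) (Fin r) ℝ) ∧ S₁ = S - B₂

/-! The Riccati equation is linearised by its Hamiltonian system: with `U = hamNumer`, `W =
hamDenom`, the flow is `U W⁻¹` and the transition matrix is the transpose of `W⁻¹`. The form `(W
x)·(U x)` has derivative `(U x)·S(U x) + (W x)·R(W x)`, so it increases; this makes `W` invertible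
and gives global existence.

Observability yields `V > 0` with `AᵀV + VA ≤ S - 2V` (`exists_lyapunov`). Completing the square,
`tr(V X)` is a Lyapunov function for the nominal model and, with the same constants, for all nearby
ones (`exists_uniform_riccatiDrift`). Trajectories thus enter a ball whose radius does not depend on
the start. There the increasing form is at most a multiple of `|W x|²`, so `W` grows exponentially
(`hamDenom_growth`): a contraction rate exists.

Differences of flows are conjugated by two transition matrices, hence decay like `exp(-4νt)`; fixed
points follow. For a solution `p` of `p' = Ricc(p) + Δ`, the curve `s ↦ φ_{t-s}(p_s)` joins
`φ_t(p_0)` to `p_t` with speed at most `K exp(-4ν(t-s)) ‖Δ_s‖`, where `K` depends only on a bound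
for the trajectory (`norm_sub_phi_le_of_perturbation`). Restarting once `p` is in the absorbing ball
makes the leading constant independent of `Q`; `Q` enters only the transient.

All three conclusions are instances. For the `π`-equation, `0 ≤ Ricc^π - Ricc ≤ Ricc_π - Ricc`, so
dissipation and the size of `Δ` are inherited from the model `(A_π, R_π, S_π)`. -/

/-! ### Loewner order, traces and the spectral norm. -/

section MatrixFacts

lemma Matrix.PosSemidef.isSymm {ι : Type*} {X : Matrix ι ι ℝ} (hX : X.PosSemidef) : Xᵀ = X := by
  have := hX.isHermitian
  rwa [Matrix.IsHermitian, Matrix.conjTranspose_eq_transpose_of_trivial] at this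

variable {ι : Type*} [Fintype ι]

lemma dotProduct_self_eq_norm_sq (x : ι → ℝ) : x ⬝ᵥ x = ‖WithLp.toLp 2 x‖ ^ 2 := by
  rw [EuclideanSpace.norm_sq_eq]
  simp [dotProduct, sq]

lemma posSemidef_of_isSymm {X : Matrix ι ι ℝ} (hs : X.IsSymm)
    (h : ∀ x : ι → ℝ, 0 ≤ x ⬝ᵥ (X *ᵥ x)) : X.PosSemidef :=
  .of_dotProduct_mulVec_nonneg
    (by rw [Matrix.IsHermitian, Matrix.conjTranspose_eq_transpose_of_trivial]; exact hs)
    (by simpa using h)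

lemma Matrix.PosSemidef.dotProduct_nonneg {X : Matrix ι ι ℝ} (hX : X.PosSemidef) (x : ι → ℝ) :
    0 ≤ x ⬝ᵥ (X *ᵥ x) := by simpa using hX.dotProduct_mulVec_nonneg x

/-- Once a semi-definite matrix is factored as `Bᵀ B`, its trace against `M` is read off from
quadratic forms of `M`; most trace inequalities below reduce to this. -/
lemma trace_mul_eq_sum (M B : Matrix ι ι ℝ) :
    (M * (Bᵀ * B)).trace = ∑ i, (B i) ⬝ᵥ (M *ᵥ (B i)) := by
  rw [← Matrix.mul_assoc, Matrix.trace_mul_comm, ← Matrix.mul_assoc]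
  simp only [Matrix.trace, Matrix.diag, Matrix.mul_apply, dotProduct, Matrix.mulVec,
    Matrix.transpose_apply, Finset.sum_mul, Finset.mul_sum]
  refine Finset.sum_congr rfl fun i _ => ?_
  rw [Finset.sum_comm]
  refine Finset.sum_congr rfl fun j _ => Finset.sum_congr rfl fun k _ => by ring

lemma Matrix.PosSemidef.transpose_mul_mul {X : Matrix ι ι ℝ} (hX : X.PosSemidef) (B : Matrix ι ι ℝ) :
    (Bᵀ * X * B).PosSemidef := by
  simpa [Matrix.conjTranspose_eq_transpose_of_trivial] using hX.conjTranspose_mul_mul_same B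

variable [DecidableEq ι]

lemma mulVec_dotProduct_self_le (M : Matrix ι ι ℝ) (x : ι → ℝ) :
    (M *ᵥ x) ⬝ᵥ (M *ᵥ x) ≤ ‖M‖ ^ 2 * (x ⬝ᵥ x) := by
  rw [dotProduct_self_eq_norm_sq, dotProduct_self_eq_norm_sq, ← mul_pow]
  gcongr
  exact Matrix.l2_opNorm_mulVec M (WithLp.toLp 2 x)

lemma abs_dotProduct_mulVec_le (M : Matrix ι ι ℝ) (x : ι → ℝ) :
    |x ⬝ᵥ (M *ᵥ x)| ≤ ‖M‖ * (x ⬝ᵥ x) := by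
  have h := abs_real_inner_le_norm (WithLp.toLp 2 (M *ᵥ x)) (WithLp.toLp 2 x)
  rw [EuclideanSpace.inner_toLp_toLp] at h
  simp only [star_trivial] at h
  refine h.trans ?_
  rw [dotProduct_self_eq_norm_sq]
  have := Matrix.l2_opNorm_mulVec M (WithLp.toLp 2 x)
  calc _ ≤ (‖M‖ * ‖WithLp.toLp 2 x‖) * ‖WithLp.toLp 2 x‖ := by
        gcongr; exact this
    _ = _ := by ring

lemma l2_opNorm_le_of_mulVec (M : Matrix ι ι ℝ) {c : ℝ} (hc : 0 ≤ c)
    (h : ∀ x : ι → ℝ, (M *ᵥ x) ⬝ᵥ (M *ᵥ x) ≤ c ^ 2 * (x ⬝ᵥ x)) : ‖M‖ ≤ c := by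
  rw [Matrix.l2_opNorm_def]
  refine ContinuousLinearMap.opNorm_le_bound _ hc fun x => ?_
  have := h x.ofLp
  rw [dotProduct_self_eq_norm_sq, dotProduct_self_eq_norm_sq, ← mul_pow] at this
  exact le_of_sq_le_sq this (by positivity)

lemma l2_opNorm_transpose (M : Matrix ι ι ℝ) : ‖Mᵀ‖ = ‖M‖ := by
  rw [← Matrix.conjTranspose_eq_transpose_of_trivial, Matrix.l2_opNorm_conjTranspose]

open scoped MatrixOrder in
lemma Matrix.PosSemidef.exists_eq_transpose_mul_self {X : Matrix ι ι ℝ} (hX : X.PosSemidef) :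
    ∃ B : Matrix ι ι ℝ, X = Bᵀ * B := by
  obtain ⟨B, hB⟩ := CStarAlgebra.nonneg_iff_eq_star_mul_self.mp hX.nonneg
  exact ⟨B, by rw [hB, Matrix.star_eq_conjTranspose, Matrix.conjTranspose_eq_transpose_of_trivial]⟩

/-- With `X = Bᵀ B` the quadratic form is `|B x|²`, so `‖B‖ ≤ √c` and `‖X‖ ≤ ‖B‖²`. -/
lemma Matrix.PosSemidef.l2_opNorm_le {X : Matrix ι ι ℝ} (hX : X.PosSemidef) {c : ℝ} (hc : 0 ≤ c)
    (h : ∀ x : ι → ℝ, x ⬝ᵥ (X *ᵥ x) ≤ c * (x ⬝ᵥ x)) : ‖X‖ ≤ c := by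
  obtain ⟨B, rfl⟩ := Matrix.PosSemidef.exists_eq_transpose_mul_self hX
  have hB : ‖B‖ ≤ √c := by
    refine l2_opNorm_le_of_mulVec _ (Real.sqrt_nonneg _) fun x => ?_
    rw [Real.sq_sqrt hc]
    convert h x using 1
    rw [← Matrix.mulVec_mulVec, Matrix.dotProduct_mulVec, Matrix.dotProduct_mulVec,
      Matrix.vecMul_transpose]
    simp [Matrix.dotProduct_mulVec]
  calc ‖Bᵀ * B‖ ≤ ‖Bᵀ‖ * ‖B‖ := norm_mul_le _ _
    _ = ‖B‖ * ‖B‖ := by rw [l2_opNorm_transpose]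
    _ ≤ √c * √c := by gcongr
    _ = c := Real.mul_self_sqrt hc

lemma Matrix.PosSemidef.l2_opNorm_le_of_le {X Y : Matrix ι ι ℝ} (hX : X.PosSemidef)
    (h : (Y - X).PosSemidef) : ‖X‖ ≤ ‖Y‖ := by
  refine Matrix.PosSemidef.l2_opNorm_le hX (norm_nonneg _) fun x => ?_
  have h1 := Matrix.PosSemidef.dotProduct_nonneg h x
  rw [Matrix.sub_mulVec, dotProduct_sub] at h1
  have h2 := (le_abs_self _).trans (abs_dotProduct_mulVec_le Y x)
  linarith

lemma Matrix.PosSemidef.abs_trace_mul_le (M : Matrix ι ι ℝ) {X : Matrix ι ι ℝ} (hX : X.PosSemidef) :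
    |(M * X).trace| ≤ ‖M‖ * X.trace := by
  obtain ⟨B, rfl⟩ := Matrix.PosSemidef.exists_eq_transpose_mul_self hX
  rw [← one_mul (Bᵀ * B), ← mul_assoc, mul_one, trace_mul_eq_sum, trace_mul_eq_sum,
    Finset.mul_sum]
  refine (Finset.abs_sum_le_sum_abs _ _).trans (Finset.sum_le_sum fun i _ => ?_)
  rw [Matrix.one_mulVec]
  exact abs_dotProduct_mulVec_le M _

lemma Matrix.PosSemidef.trace_mul_nonneg {M X : Matrix ι ι ℝ} (hM : M.PosSemidef) (hX : X.PosSemidef) :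
    0 ≤ (M * X).trace := by
  obtain ⟨B, rfl⟩ := Matrix.PosSemidef.exists_eq_transpose_mul_self hX
  rw [trace_mul_eq_sum]
  exact Finset.sum_nonneg fun i _ => Matrix.PosSemidef.dotProduct_nonneg hM _

lemma Matrix.PosSemidef.l2_opNorm_le_trace {X : Matrix ι ι ℝ} (hX : X.PosSemidef) : ‖X‖ ≤ X.trace := by
  refine Matrix.PosSemidef.l2_opNorm_le hX hX.trace_nonneg fun x => ?_
  obtain ⟨B, rfl⟩ := Matrix.PosSemidef.exists_eq_transpose_mul_self hX
  have h1 : x ⬝ᵥ ((Bᵀ * B) *ᵥ x) = ∑ i, (B i ⬝ᵥ x) ^ 2 := by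
    rw [← Matrix.mulVec_mulVec, Matrix.dotProduct_mulVec, Matrix.vecMul_transpose]
    simp [dotProduct, Matrix.mulVec, sq]
  have h2 : (Bᵀ * B).trace = ∑ i, B i ⬝ᵥ B i := by
    rw [← one_mul (Bᵀ * B), trace_mul_eq_sum]; simp
  rw [h1, h2, Finset.sum_mul]
  refine Finset.sum_le_sum fun i _ => ?_
  have := Finset.sum_mul_sq_le_sq_mul_sq Finset.univ (B i) x
  simpa [dotProduct, sq] using this

lemma Matrix.PosDef.exists_pos_mul_le {V : Matrix ι ι ℝ} (hV : V.PosDef) :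
    ∃ c : ℝ, 0 < c ∧ ∀ x : ι → ℝ, c * (x ⬝ᵥ x) ≤ x ⬝ᵥ (V *ᵥ x) := by
  obtain ⟨B, hB⟩ := Matrix.PosSemidef.exists_eq_transpose_mul_self hV.posSemidef
  have hu : IsUnit B.det := by
    have := (Matrix.isUnit_iff_isUnit_det _).1 hV.isUnit
    rw [hB, Matrix.det_mul] at this
    exact isUnit_of_mul_isUnit_right this
  -- From `|x| ≤ ‖B⁻¹‖ |B x|`; the `+ 1` keeps the constant positive even if `‖B⁻¹‖ = 0`, as in
  -- dimension zero.
  refine ⟨((‖B⁻¹‖ ^ 2 + 1))⁻¹, by positivity, fun x => ?_⟩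
  rw [inv_mul_le_iff₀ (by positivity)]
  have h1 : x ⬝ᵥ (V *ᵥ x) = (B *ᵥ x) ⬝ᵥ (B *ᵥ x) := by
    rw [hB, ← Matrix.mulVec_mulVec, Matrix.dotProduct_mulVec, Matrix.vecMul_transpose]
  have h2 := mulVec_dotProduct_self_le B⁻¹ (B *ᵥ x)
  rw [Matrix.mulVec_mulVec, Matrix.nonsing_inv_mul _ hu, Matrix.one_mulVec, ← h1] at h2
  have := Matrix.PosSemidef.dotProduct_nonneg hV.posSemidef x
  linarith

/-- Together with `Matrix.PosSemidef.l2_opNorm_le_trace`, this lets `tr(V X)` control `‖X‖` on the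
cone. -/
lemma Matrix.PosDef.exists_trace_le {V : Matrix ι ι ℝ} (hV : V.PosDef) :
    ∃ c : ℝ, 0 < c ∧ ∀ X : Matrix ι ι ℝ, X.PosSemidef → X.trace ≤ c * (V * X).trace := by
  obtain ⟨c, hc, h⟩ := Matrix.PosDef.exists_pos_mul_le hV
  refine ⟨c⁻¹, by positivity, fun X hX => ?_⟩
  rw [le_inv_mul_iff₀ hc]
  obtain ⟨B, rfl⟩ := Matrix.PosSemidef.exists_eq_transpose_mul_self hX
  rw [trace_mul_eq_sum, ← one_mul (Bᵀ * B), trace_mul_eq_sum, Finset.mul_sum]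
  exact Finset.sum_le_sum fun i _ => by simpa using h (B i)

lemma Matrix.PosSemidef.trace_le_mul_l2_opNorm {X : Matrix ι ι ℝ} :
    X.trace ≤ Fintype.card ι * ‖X‖ := by
  have : X.trace ≤ ∑ _i : ι, ‖X‖ := by
    refine Finset.sum_le_sum fun i _ => ?_
    have := (le_abs_self _).trans (abs_dotProduct_mulVec_le X (Pi.single i 1))
    simpa using this
  simpa using this

end MatrixFacts

/-! ### Differential inequalities on a half-line. -/

section Calculus

open Set

lemma HasDerivWithinAt.linearMap_comp {E F : Type*} [NormedAddCommGroup E] [NormedSpace ℝ E]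
    [FiniteDimensional ℝ E] [NormedAddCommGroup F] [NormedSpace ℝ F] (l : E →ₗ[ℝ] F)
    {f : ℝ → E} {f' : E} {s : Set ℝ} {t : ℝ} (h : HasDerivWithinAt f f' s t) :
    HasDerivWithinAt (fun u => l (f u)) (l f') s t :=
  (LinearMap.toContinuousLinearMap l).hasFDerivAt.comp_hasDerivWithinAt t h

lemma HasDerivWithinAt.matrix_transpose {ι : Type*} [Fintype ι] [DecidableEq ι]
    {f : ℝ → Matrix ι ι ℝ} {f' : Matrix ι ι ℝ} {s : Set ℝ} {t : ℝ}
    (h : HasDerivWithinAt f f' s t) : HasDerivWithinAt (fun u => (f u)ᵀ) f'ᵀ s t :=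
  h.linearMap_comp (Matrix.transposeLinearEquiv ι ι ℝ ℝ).toLinearMap

/-- A linear differential inequality on a half-line. -/
lemma le_mul_exp_of_deriv_le {h h' : ℝ → ℝ} {a k : ℝ}
    (hd : ∀ t, a ≤ t → HasDerivWithinAt h (h' t) (Ici a) t) (hk : ∀ t, a ≤ t → h' t ≤ k * h t)
    {t : ℝ} (ht : a ≤ t) : h t ≤ h a * Real.exp (k * (t - a)) := by
  have hg : ∀ t, a ≤ t → HasDerivWithinAt (fun s => h s * Real.exp (-k * (s - a)))
      ((h' t - k * h t) * Real.exp (-k * (t - a))) (Ici a) t := by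
    intro t ht
    have h1 : HasDerivWithinAt (fun s : ℝ => Real.exp (-k * (s - a)))
        (Real.exp (-k * (t - a)) * (-k * 1)) (Ici a) t :=
      ((((hasDerivAt_id t).sub_const a).const_mul (-k)).exp).hasDerivWithinAt
    refine ((hd t ht).mul h1).congr_deriv ?_
    ring
  have hanti : AntitoneOn (fun s => h s * Real.exp (-k * (s - a))) (Ici a) := by
    refine antitoneOn_of_deriv_nonpos (convex_Ici a) (fun t ht => (hg t ht).continuousWithinAt)
      (fun t ht => ?_) (fun t ht => ?_)
    · rw [interior_Ici] at ht ⊢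
      exact ((hg t (le_of_lt ht)).differentiableWithinAt).mono Ioi_subset_Ici_self
    · rw [interior_Ici] at ht
      rw [((hg t (le_of_lt ht)).hasDerivAt (Ici_mem_nhds ht)).deriv]
      exact mul_nonpos_of_nonpos_of_nonneg (by linarith [hk t (le_of_lt ht)]) (Real.exp_pos _).le
  have := hanti self_mem_Ici ht ht
  simp only [sub_self, mul_zero, Real.exp_zero, mul_one] at this
  calc h t = h t * Real.exp (-k * (t - a)) * Real.exp (k * (t - a)) := by
        rw [mul_assoc, ← Real.exp_add]; simp
    _ ≤ _ := by gcongr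

lemma mul_exp_le_of_le_deriv {h h' : ℝ → ℝ} {a k : ℝ}
    (hd : ∀ t, a ≤ t → HasDerivWithinAt h (h' t) (Ici a) t) (hk : ∀ t, a ≤ t → k * h t ≤ h' t)
    {t : ℝ} (ht : a ≤ t) : h a * Real.exp (k * (t - a)) ≤ h t := by
  have := le_mul_exp_of_deriv_le (h := fun s => - h s) (h' := fun s => - h' s) (k := k)
    (fun t ht => (hd t ht).neg) (fun t ht => by linarith [hk t ht]) ht
  linarith

/-- A linear homogeneous Sylvester differential equation with zero initial value. -/
lemma eq_zero_of_linear_deriv {r : ℕ} {D M N : ℝ → Matrix (Fin r) (Fin r) ℝ}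
    (hM : ContinuousOn M (Ici 0)) (hN : ContinuousOn N (Ici 0)) (h0 : D 0 = 0)
    (hd : ∀ t, 0 ≤ t → HasDerivWithinAt D (M t * D t + D t * N t) (Ici 0) t)
    {t : ℝ} (ht : 0 ≤ t) : D t = 0 := by
  obtain ⟨K, hK⟩ := (isCompact_Icc (a := (0 : ℝ)) (b := t)).exists_bound_of_continuousOn
    (hM.mono Icc_subset_Ici_self)
  obtain ⟨K', hK'⟩ := (isCompact_Icc (a := (0 : ℝ)) (b := t)).exists_bound_of_continuousOn
    (hN.mono Icc_subset_Ici_self)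
  have := norm_le_gronwallBound_of_norm_deriv_right_le (f := D)
    (f' := fun t => M t * D t + D t * N t) (δ := 0) (K := K + K') (ε := 0) (a := 0) (b := t)
    (fun s hs => ((hd s hs.1).continuousWithinAt).mono Icc_subset_Ici_self)
    (fun s hs => (hd s hs.1).mono (Ici_subset_Ici.2 hs.1)) (by simp [h0])
    (fun s hs => ?_) t ⟨ht, le_rfl⟩
  · rw [gronwallBound_ε0] at this
    simpa using this
  · have hs' : s ∈ Icc 0 t := ⟨hs.1, hs.2.le⟩
    calc ‖M s * D s + D s * N s‖ ≤ ‖M s‖ * ‖D s‖ + ‖D s‖ * ‖N s‖ :=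
          (norm_add_le _ _).trans (add_le_add (norm_mul_le _ _) (norm_mul_le _ _))
      _ ≤ K * ‖D s‖ + ‖D s‖ * K' := by
          gcongr
          · exact hK s hs'
          · exact hK' s hs'
      _ = _ := by ring

end Calculus

/-! ### Global solutions through the Hamiltonian system. -/

section WellPosed

open Set

variable {r : ℕ}

lemma HasDerivWithinAt.matrix_inv {f : ℝ → Matrix (Fin r) (Fin r) ℝ}
    {f' : Matrix (Fin r) (Fin r) ℝ} {s : Set ℝ} {t : ℝ} (h : HasDerivWithinAt f f' s t)
    (hu : IsUnit (f t)) :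
    HasDerivWithinAt (fun u => (f u)⁻¹) (-((f t)⁻¹ * f' * (f t)⁻¹)) s t := by
  obtain ⟨u, hu⟩ := hu
  have h1 := hasFDerivAt_ringInverse (𝕜 := ℝ) u
  rw [hu] at h1
  have h2 := h1.comp_hasDerivWithinAt t h
  have h3 : (↑u⁻¹ : Matrix (Fin r) (Fin r) ℝ) = (f t)⁻¹ := by
    rw [← hu, Matrix.coe_units_inv]
  rw [h3] at h2
  have h4 : (fun u => (f u)⁻¹) = Ring.inverse ∘ f := by
    funext u; simp [Matrix.nonsing_inv_eq_ringInverse]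
  rw [h4]
  simpa using h2

/-- The first block of the solution of the linear Hamiltonian system `U' = A U + R V`,
`V' = S U - A' V` started at `(Q, 1)`. -/
noncomputable def hamNumer (A R S Q : Matrix (Fin r) (Fin r) ℝ) (t : ℝ) :
    Matrix (Fin r) (Fin r) ℝ :=
  (NormedSpace.exp (t • Matrix.fromBlocks A R S (-Aᵀ))).toBlocks₁₁ * Q +
    (NormedSpace.exp (t • Matrix.fromBlocks A R S (-Aᵀ))).toBlocks₁₂

/-- The second block of the solution of the linear Hamiltonian system. -/
noncomputable def hamDenom (A R S Q : Matrix (Fin r) (Fin r) ℝ) (t : ℝ) :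
    Matrix (Fin r) (Fin r) ℝ :=
  (NormedSpace.exp (t • Matrix.fromBlocks A R S (-Aᵀ))).toBlocks₂₁ * Q +
    (NormedSpace.exp (t • Matrix.fromBlocks A R S (-Aᵀ))).toBlocks₂₂

variable {A R S Q : Matrix (Fin r) (Fin r) ℝ}

lemma hamNumer_zero : hamNumer A R S Q 0 = Q := by
  simp [hamNumer, ← Matrix.fromBlocks_one]

lemma hamDenom_zero : hamDenom A R S Q 0 = 1 := by
  simp [hamDenom, ← Matrix.fromBlocks_one]

lemma hasDerivWithinAt_hamNumer (s : Set ℝ) (t : ℝ) :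
    HasDerivWithinAt (hamNumer A R S Q) (A * hamNumer A R S Q t + R * hamDenom A R S Q t) s t := by
  have h := (hasDerivAt_exp_smul_const' (𝕂 := ℝ) (Matrix.fromBlocks A R S (-Aᵀ)) t).hasDerivWithinAt
    (s := s)
  let l : Matrix (Fin r ⊕ Fin r) (Fin r ⊕ Fin r) ℝ →ₗ[ℝ] Matrix (Fin r) (Fin r) ℝ :=
    { toFun := fun M => M.toBlocks₁₁ * Q + M.toBlocks₁₂
      map_add' := fun M N => by
        have h1 : (M + N).toBlocks₁₁ = M.toBlocks₁₁ + N.toBlocks₁₁ := rfl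
        have h2 : (M + N).toBlocks₁₂ = M.toBlocks₁₂ + N.toBlocks₁₂ := rfl
        rw [h1, h2, add_mul]; abel
      map_smul' := fun c M => by
        have h1 : (c • M).toBlocks₁₁ = c • M.toBlocks₁₁ := rfl
        have h2 : (c • M).toBlocks₁₂ = c • M.toBlocks₁₂ := rfl
        rw [h1, h2, smul_mul_assoc, ← smul_add]; rfl }
  refine (h.linearMap_comp l).congr_deriv ?_
  simp only [l, LinearMap.coe_mk, AddHom.coe_mk, hamNumer, hamDenom]
  set M := NormedSpace.exp (t • Matrix.fromBlocks A R S (-Aᵀ))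
  rw [← Matrix.fromBlocks_toBlocks M, Matrix.fromBlocks_multiply]
  simp only [Matrix.toBlocks_fromBlocks₁₁, Matrix.toBlocks_fromBlocks₁₂,
    Matrix.toBlocks_fromBlocks₂₁, Matrix.toBlocks_fromBlocks₂₂]
  noncomm_ring

lemma hasDerivWithinAt_hamDenom (s : Set ℝ) (t : ℝ) :
    HasDerivWithinAt (hamDenom A R S Q) (S * hamNumer A R S Q t - Aᵀ * hamDenom A R S Q t) s t := by
  have h := (hasDerivAt_exp_smul_const' (𝕂 := ℝ) (Matrix.fromBlocks A R S (-Aᵀ)) t).hasDerivWithinAt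
    (s := s)
  let l : Matrix (Fin r ⊕ Fin r) (Fin r ⊕ Fin r) ℝ →ₗ[ℝ] Matrix (Fin r) (Fin r) ℝ :=
    { toFun := fun M => M.toBlocks₂₁ * Q + M.toBlocks₂₂
      map_add' := fun M N => by
        have h1 : (M + N).toBlocks₂₁ = M.toBlocks₂₁ + N.toBlocks₂₁ := rfl
        have h2 : (M + N).toBlocks₂₂ = M.toBlocks₂₂ + N.toBlocks₂₂ := rfl
        rw [h1, h2, add_mul]; abel
      map_smul' := fun c M => by
        have h1 : (c • M).toBlocks₂₁ = c • M.toBlocks₂₁ := rfl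
        have h2 : (c • M).toBlocks₂₂ = c • M.toBlocks₂₂ := rfl
        rw [h1, h2, smul_mul_assoc, ← smul_add]; rfl }
  refine (h.linearMap_comp l).congr_deriv ?_
  simp only [l, LinearMap.coe_mk, AddHom.coe_mk, hamNumer, hamDenom]
  set M := NormedSpace.exp (t • Matrix.fromBlocks A R S (-Aᵀ))
  rw [← Matrix.fromBlocks_toBlocks M, Matrix.fromBlocks_multiply]
  simp only [Matrix.toBlocks_fromBlocks₁₁, Matrix.toBlocks_fromBlocks₁₂,
    Matrix.toBlocks_fromBlocks₂₁, Matrix.toBlocks_fromBlocks₂₂]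
  noncomm_ring

/-- The terms in `A` cancel because of the block `-Aᵀ`; only congruences of `S` and `R` remain,
which is the source of monotonicity. -/
lemma hasDerivWithinAt_hamDenom_transpose_mul_hamNumer (hS : Sᵀ = S) (s : Set ℝ) (t : ℝ) :
    HasDerivWithinAt (fun t => (hamDenom A R S Q t)ᵀ * hamNumer A R S Q t)
      ((hamNumer A R S Q t)ᵀ * S * hamNumer A R S Q t +
        (hamDenom A R S Q t)ᵀ * R * hamDenom A R S Q t) s t := by
  refine ((hasDerivWithinAt_hamDenom s t).matrix_transpose.mul
    (hasDerivWithinAt_hamNumer s t)).congr_deriv ?_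
  simp only [Matrix.transpose_sub, Matrix.transpose_mul, Matrix.transpose_transpose, hS]
  noncomm_ring

/-- The linear functional `M ↦ x' M x`. -/
def quadFormLin (x : Fin r → ℝ) : Matrix (Fin r) (Fin r) ℝ →ₗ[ℝ] ℝ where
  toFun M := x ⬝ᵥ (M *ᵥ x)
  map_add' M N := by rw [Matrix.add_mulVec, dotProduct_add]
  map_smul' c M := by rw [Matrix.smul_mulVec, dotProduct_smul]; rfl

lemma dotProduct_transpose_mul_mul_mulVec (M N X : Matrix (Fin r) (Fin r) ℝ) (x : Fin r → ℝ) :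
    x ⬝ᵥ ((Mᵀ * X * N) *ᵥ x) = (M *ᵥ x) ⬝ᵥ (X *ᵥ (N *ᵥ x)) := by
  rw [Matrix.mul_assoc, ← Matrix.mulVec_mulVec, Matrix.dotProduct_mulVec, Matrix.vecMul_transpose,
    ← Matrix.mulVec_mulVec]

lemma hasDerivWithinAt_hamForm (hS : Sᵀ = S) (x : Fin r → ℝ) (s : Set ℝ) (t : ℝ) :
    HasDerivWithinAt (fun t => (hamDenom A R S Q t *ᵥ x) ⬝ᵥ (hamNumer A R S Q t *ᵥ x))
      ((hamNumer A R S Q t *ᵥ x) ⬝ᵥ (S *ᵥ (hamNumer A R S Q t *ᵥ x)) +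
        (hamDenom A R S Q t *ᵥ x) ⬝ᵥ (R *ᵥ (hamDenom A R S Q t *ᵥ x))) s t := by
  have h := (hasDerivWithinAt_hamDenom_transpose_mul_hamNumer (A := A) (R := R) (Q := Q)
    hS s t).linearMap_comp (quadFormLin x)
  have e : ∀ t, quadFormLin x ((hamDenom A R S Q t)ᵀ * hamNumer A R S Q t) =
      (hamDenom A R S Q t *ᵥ x) ⬝ᵥ (hamNumer A R S Q t *ᵥ x) := fun t => by
    have := dotProduct_transpose_mul_mul_mulVec (hamDenom A R S Q t) (hamNumer A R S Q t) 1 x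
    rwa [Matrix.mul_one, Matrix.one_mulVec] at this
  simp only [e] at h
  refine h.congr_deriv ?_
  rw [map_add]
  exact congrArg₂ _ (dotProduct_transpose_mul_mul_mulVec _ _ _ _)
    (dotProduct_transpose_mul_mul_mulVec _ _ _ _)

/-- The derivative is symmetric, so the antisymmetric part is constant, and it vanishes at time
zero. -/
lemma hamDenom_transpose_mul_hamNumer_symm (hQ : Qᵀ = Q) (hR : Rᵀ = R) (hS : Sᵀ = S) {t : ℝ}
    (ht : 0 ≤ t) : ((hamDenom A R S Q t)ᵀ * hamNumer A R S Q t)ᵀ =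
      (hamDenom A R S Q t)ᵀ * hamNumer A R S Q t := by
  rw [← sub_eq_zero]
  refine eq_zero_of_linear_deriv (D := fun t => ((hamDenom A R S Q t)ᵀ * hamNumer A R S Q t)ᵀ -
      (hamDenom A R S Q t)ᵀ * hamNumer A R S Q t) (M := 0) (N := 0) continuousOn_const
      continuousOn_const ?_ (fun t _ => ?_) ht
  · simp [hamNumer_zero, hamDenom_zero, hQ]
  · have h := hasDerivWithinAt_hamDenom_transpose_mul_hamNumer (A := A) (R := R) (Q := Q)
      hS (Ici 0) t
    refine (h.matrix_transpose.sub h).congr_deriv ?_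
    simp [hS, hR, Matrix.mul_assoc]

lemma hamForm_monotoneOn (hR : R.PosDef) (hS : S.PosSemidef)
    (x : Fin r → ℝ) :
    MonotoneOn (fun t => (hamDenom A R S Q t *ᵥ x) ⬝ᵥ (hamNumer A R S Q t *ᵥ x)) (Ici 0) := by
  have h := fun t => hasDerivWithinAt_hamForm (A := A) (R := R) (Q := Q) hS.isSymm x (Ici 0) t
  refine monotoneOn_of_deriv_nonneg (convex_Ici 0) (fun t _ => (h t).continuousWithinAt)
    (fun t ht => ?_) (fun t ht => ?_)
  · exact ((h t).differentiableWithinAt).mono interior_subset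
  · rw [((h t).hasDerivAt (mem_interior_iff_mem_nhds.1 ht)).deriv]
    exact add_nonneg (hS.dotProduct_nonneg _) (hR.posSemidef.dotProduct_nonneg _)

lemma hamForm_nonneg (hQ : Q.PosSemidef) (hR : R.PosDef) (hS : S.PosSemidef)
    (x : Fin r → ℝ) {t : ℝ} (ht : 0 ≤ t) :
    0 ≤ (hamDenom A R S Q t *ᵥ x) ⬝ᵥ (hamNumer A R S Q t *ᵥ x) := by
  refine le_trans ?_ (hamForm_monotoneOn hR hS x self_mem_Ici ht ht)
  simpa [hamNumer_zero, hamDenom_zero] using hQ.dotProduct_nonneg x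

/-- If the denominator killed `x ≠ 0` at time `t`, the nonnegative increasing form would vanish on
`[0, t]`, whereas its derivative at `0` is at least `x·R x > 0`. -/
lemma isUnit_hamDenom (hQ : Q.PosSemidef) (hR : R.PosDef) (hS : S.PosSemidef) {t : ℝ}
    (ht : 0 ≤ t) : IsUnit (hamDenom A R S Q t) := by
  rcases ht.eq_or_lt with rfl | ht0
  · rw [hamDenom_zero]; exact isUnit_one
  rw [Matrix.isUnit_iff_isUnit_det, isUnit_iff_ne_zero]
  intro hdet
  obtain ⟨x, hx, hVx⟩ := Matrix.exists_mulVec_eq_zero_iff.2 hdet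
  have hzero : ∀ s ∈ Icc 0 t, (hamDenom A R S Q s *ᵥ x) ⬝ᵥ (hamNumer A R S Q s *ᵥ x) = 0 := by
    intro s hs
    refine le_antisymm ?_ (hamForm_nonneg hQ hR hS x hs.1)
    have := hamForm_monotoneOn (A := A) (Q := Q) hR hS x hs.1 ht hs.2
    simpa [hVx] using this
  have h0 : (0 : ℝ) ∈ Icc 0 t := ⟨le_rfl, ht⟩
  have hd := hasDerivWithinAt_hamForm (A := A) (R := R) (Q := Q) hS.isSymm x (Icc 0 t) 0
  have hd0 := (hasDerivWithinAt_const (0 : ℝ) (Icc 0 t) (0 : ℝ)).congr hzero (hzero 0 h0)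
  have := (uniqueDiffOn_Icc ht0 0 h0).eq_deriv _ hd hd0
  rw [hamNumer_zero, hamDenom_zero, Matrix.one_mulVec] at this
  have hpos := hR.dotProduct_mulVec_pos hx
  rw [star_trivial] at hpos
  linarith [hS.dotProduct_nonneg (Q *ᵥ x)]

/-- The ratio `U W⁻¹` is the congruence of `Wᵀ U` by `W⁻¹`. -/
lemma posSemidef_hamNumer_mul_inv (hQ : Q.PosSemidef) (hR : R.PosDef) (hS : S.PosSemidef) {t : ℝ}
    (ht : 0 ≤ t) : (hamNumer A R S Q t * (hamDenom A R S Q t)⁻¹).PosSemidef := by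
  have hu := (Matrix.isUnit_iff_isUnit_det _).1 (isUnit_hamDenom (A := A) hQ hR hS ht)
  have hW : ((hamDenom A R S Q t)ᵀ * hamNumer A R S Q t).PosSemidef := by
    refine posSemidef_of_isSymm (hamDenom_transpose_mul_hamNumer_symm hQ.isSymm
      hR.posSemidef.isSymm hS.isSymm ht) fun x => ?_
    have := dotProduct_transpose_mul_mul_mulVec (hamDenom A R S Q t) (hamNumer A R S Q t) 1 x
    rw [Matrix.mul_one, Matrix.one_mulVec] at this
    rw [this]
    exact hamForm_nonneg hQ hR hS x ht
  have := hW.transpose_mul_mul (hamDenom A R S Q t)⁻¹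
  rwa [Matrix.transpose_nonsing_inv, ← Matrix.mul_assoc, Matrix.nonsing_inv_mul, Matrix.one_mul]
    at this
  rwa [Matrix.det_transpose]

lemma hasDerivWithinAt_hamRatio (hQ : Q.PosSemidef) (hR : R.PosDef) (hS : S.PosSemidef) {t : ℝ}
    (ht : 0 ≤ t) : HasDerivWithinAt (fun t => hamNumer A R S Q t * (hamDenom A R S Q t)⁻¹)
      (ricc A R S (hamNumer A R S Q t * (hamDenom A R S Q t)⁻¹)) (Ici 0) t := by
  have hu := isUnit_hamDenom (A := A) hQ hR hS ht
  refine ((hasDerivWithinAt_hamNumer _ t).mul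
    ((hasDerivWithinAt_hamDenom _ t).matrix_inv hu)).congr_deriv ?_
  have hi := Matrix.mul_nonsing_inv _ ((Matrix.isUnit_iff_isUnit_det _).1 hu)
  simp only [ricc, add_mul, mul_assoc, mul_sub, sub_mul, hi, mul_neg, mul_one]
  abel

/-- The transition matrix of the closed loop drift, in Hamiltonian form. -/
lemma hasDerivWithinAt_hamDenom_inv_transpose (hQ : Q.PosSemidef) (hR : R.PosDef)
    (hS : S.PosSemidef) {t : ℝ} (ht : 0 ≤ t) :
    HasDerivWithinAt (fun t => ((hamDenom A R S Q t)⁻¹)ᵀ)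
      ((A - hamNumer A R S Q t * (hamDenom A R S Q t)⁻¹ * S) * ((hamDenom A R S Q t)⁻¹)ᵀ)
      (Ici 0) t := by
  have hu := isUnit_hamDenom (A := A) hQ hR hS ht
  refine (((hasDerivWithinAt_hamDenom _ t).matrix_inv hu).matrix_transpose).congr_deriv ?_
  have hi := Matrix.mul_nonsing_inv _ ((Matrix.isUnit_iff_isUnit_det _).1 hu)
  have hX := (posSemidef_hamNumer_mul_inv (A := A) hQ hR hS ht).isSymm
  rw [← hX]
  have : (hamDenom A R S Q t)⁻¹ * (S * hamNumer A R S Q t - Aᵀ * hamDenom A R S Q t) *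
      (hamDenom A R S Q t)⁻¹ = (hamDenom A R S Q t)⁻¹ *
      (S * (hamNumer A R S Q t * (hamDenom A R S Q t)⁻¹) - Aᵀ) := by
    simp only [mul_assoc, sub_mul, hi, mul_one]
  rw [this, ← mul_neg, Matrix.transpose_mul, neg_sub, Matrix.transpose_sub,
    Matrix.transpose_transpose, Matrix.transpose_mul, hS.isSymm]

/-- From `XSX - YSY = XS(X - Y) + (X - Y)SY`. Differences of solutions therefore solve a linear
Sylvester equation, whence uniqueness and the conjugation formula. -/
lemma ricc_sub_ricc (X Y : Matrix (Fin r) (Fin r) ℝ) (hY : Yᵀ = Y) (hS : Sᵀ = S) :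
    ricc A R S X - ricc A R S Y = (A - X * S) * (X - Y) + (X - Y) * (A - Y * S)ᵀ := by
  simp only [ricc, Matrix.transpose_sub, Matrix.transpose_mul, hS, hY]
  noncomm_ring

lemma IsRiccatiSolution.continuousOn {F : PSDMat r → Matrix (Fin r) (Fin r) ℝ} {Q : PSDMat r}
    {p : ℝ → PSDMat r} (h : IsRiccatiSolution F Q p) :
    ContinuousOn (fun t => (p t).1) (Ici 0) :=
  fun t ht => (h.2 t ht).continuousWithinAt

lemma continuousOn_closedLoop {p : ℝ → Matrix (Fin r) (Fin r) ℝ} (hp : ContinuousOn p (Ici 0)) :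
    ContinuousOn (fun t => A - p t * S) (Ici 0) :=
  continuousOn_const.sub (hp.mul continuousOn_const)

/-- The difference of two solutions of the Riccati equation is conjugated by the transition
matrices of the closed loop drifts. -/
lemma IsRiccatiSolution.sub_eq (hS : Sᵀ = S) {Q₁ Q₂ : PSDMat r} {p q : ℝ → PSDMat r}
    (hp : IsRiccatiSolution (fun X => ricc A R S X.1) Q₁ p)
    (hq : IsRiccatiSolution (fun X => ricc A R S X.1) Q₂ q)
    {E F : ℝ → Matrix (Fin r) (Fin r) ℝ} (hE0 : E 0 = 1) (hF0 : F 0 = 1)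
    (hE : ∀ t, 0 ≤ t → HasDerivWithinAt E ((A - (p t).1 * S) * E t) (Ici 0) t)
    (hF : ∀ t, 0 ≤ t → HasDerivWithinAt F ((A - (q t).1 * S) * F t) (Ici 0) t)
    {t : ℝ} (ht : 0 ≤ t) : (p t).1 - (q t).1 = E t * (Q₁.1 - Q₂.1) * (F t)ᵀ := by
  rw [← sub_eq_zero]
  refine eq_zero_of_linear_deriv
    (D := fun t => (p t).1 - (q t).1 - E t * (Q₁.1 - Q₂.1) * (F t)ᵀ)
    (M := fun t => A - (p t).1 * S) (N := fun t => (A - (q t).1 * S)ᵀ)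
    (continuousOn_closedLoop hp.continuousOn)
    ((continuous_id.matrix_transpose).comp_continuousOn (continuousOn_closedLoop hq.continuousOn))
    ?_ (fun t ht => ?_) ht
  · simp [hp.1, hq.1, hE0, hF0]
  · refine (((hp.2 t ht).sub (hq.2 t ht)).sub
      (((hE t ht).mul_const (Q₁.1 - Q₂.1)).mul (hF t ht).matrix_transpose)).congr_deriv ?_
    rw [ricc_sub_ricc _ _ (q t).2.isSymm hS]
    simp only [Matrix.transpose_mul]
    noncomm_ring

lemma exists_isRiccatiSolution (hR : R.PosDef) (hS : S.PosSemidef) (Q : PSDMat r) :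
    ∃ p, IsRiccatiSolution (fun X : PSDMat r => ricc A R S X.1) Q p ∧
      ∀ t, 0 ≤ t → (p t).1 = hamNumer A R S Q.1 t * (hamDenom A R S Q.1 t)⁻¹ := by
  classical
  let p : ℝ → PSDMat r := fun t => if ht : 0 ≤ t then
    ⟨_, posSemidef_hamNumer_mul_inv (A := A) Q.2 hR hS ht⟩ else Q
  have hp : ∀ t, 0 ≤ t → (p t).1 = hamNumer A R S Q.1 t * (hamDenom A R S Q.1 t)⁻¹ := by
    intro t ht; simp only [p, dif_pos ht]
  refine ⟨p, ⟨Subtype.ext ?_, fun t ht => ?_⟩, hp⟩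
  · rw [hp 0 le_rfl, hamNumer_zero, hamDenom_zero]; simp
  · simp only [hp t ht]
    exact (hasDerivWithinAt_hamRatio Q.2 hR hS ht).congr (fun s hs => hp s hs) (hp t ht)

lemma IsRiccatiSolution.unique (hS : Sᵀ = S) {Q : PSDMat r} {p q : ℝ → PSDMat r}
    (hp : IsRiccatiSolution (fun X => ricc A R S X.1) Q p)
    (hq : IsRiccatiSolution (fun X => ricc A R S X.1) Q q) {t : ℝ} (ht : 0 ≤ t) : q t = p t := by
  refine Subtype.ext (sub_eq_zero.1 (eq_zero_of_linear_deriv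
    (D := fun t => (q t).1 - (p t).1)
    (M := fun t => A - (q t).1 * S) (N := fun t => (A - (p t).1 * S)ᵀ)
    (continuousOn_closedLoop hq.continuousOn)
    ((continuous_id.matrix_transpose).comp_continuousOn (continuousOn_closedLoop hp.continuousOn))
    ?_ (fun t ht => ?_) ht))
  · simp [hp.1, hq.1]
  · refine ((hq.2 t ht).sub (hp.2 t ht)).congr_deriv ?_
    rw [ricc_sub_ricc _ _ (p t).2.isSymm hS]

lemma riccatiWellPosed (hR : R.PosDef) (hS : S.PosSemidef) :
    RiccatiWellPosed (fun X : PSDMat r => ricc A R S X.1) := fun Q =>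
  let ⟨p, hp, _⟩ := exists_isRiccatiSolution hR hS Q
  ⟨p, hp, fun _ hq _ ht => hp.unique hS.isSymm hq ht⟩

lemma isRiccatiSolution_phi (hR : R.PosDef) (hS : S.PosSemidef) (Q : PSDMat r) :
    IsRiccatiSolution (fun X : PSDMat r => ricc A R S X.1) Q (fun t => phi A R S t Q) := by
  have h : ∃ p, IsRiccatiSolution (fun X : PSDMat r => ricc A R S X.1) Q p :=
    let ⟨p, hp, _⟩ := exists_isRiccatiSolution hR hS Q
    ⟨p, hp⟩
  have : (fun t => phi A R S t Q) = h.choose := by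
    funext t; simp only [phi, riccatiFlow, dif_pos h]
  rw [this]; exact h.choose_spec

lemma phi_zero (hR : R.PosDef) (hS : S.PosSemidef) (Q : PSDMat r) : phi A R S 0 Q = Q :=
  (isRiccatiSolution_phi hR hS Q).1

lemma IsRiccatiSolution.eq_phi (hR : R.PosDef) (hS : S.PosSemidef) {Q : PSDMat r}
    {p : ℝ → PSDMat r} (hp : IsRiccatiSolution (fun X => ricc A R S X.1) Q p) {t : ℝ}
    (ht : 0 ≤ t) : p t = phi A R S t Q :=
  (isRiccatiSolution_phi hR hS Q).unique hS.isSymm hp ht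

lemma IsRiccatiSolution.shift {F : PSDMat r → Matrix (Fin r) (Fin r) ℝ} {Q : PSDMat r}
    {p : ℝ → PSDMat r} (hp : IsRiccatiSolution F Q p) {s : ℝ} (hs : 0 ≤ s) :
    IsRiccatiSolution F (p s) (fun t => p (s + t)) := by
  refine ⟨by simp, fun t ht => ?_⟩
  have h1 := hp.2 (s + t) (by positivity)
  have h2 : HasDerivWithinAt (fun u : ℝ => s + u) 1 (Ici 0) t :=
    ((hasDerivAt_id t).const_add s).hasDerivWithinAt
  have := h1.scomp t h2 (fun u (hu : 0 ≤ u) => add_nonneg hs hu)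
  simpa [Function.comp_def] using this

lemma phi_add (hR : R.PosDef) (hS : S.PosSemidef) (Q : PSDMat r) {s t : ℝ} (hs : 0 ≤ s)
    (ht : 0 ≤ t) : phi A R S (s + t) Q = phi A R S t (phi A R S s Q) :=
  ((isRiccatiSolution_phi hR hS Q).shift hs).eq_phi hR hS ht

lemma phi_sub_phi (hR : R.PosDef) (hS : S.PosSemidef) {Q₁ Q₂ : PSDMat r}
    {E F : ℝ → Matrix (Fin r) (Fin r) ℝ} (hE : IsTransitionMatrix A R S Q₁ E)
    (hF : IsTransitionMatrix A R S Q₂ F) {t : ℝ} (ht : 0 ≤ t) :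
    (phi A R S t Q₁).1 - (phi A R S t Q₂).1 = E t * (Q₁.1 - Q₂.1) * (F t)ᵀ :=
  (isRiccatiSolution_phi hR hS Q₁).sub_eq hS.isSymm (isRiccatiSolution_phi hR hS Q₂)
    hE.1 hF.1 hE.2 hF.2 ht

lemma phi_eq_hamRatio (hR : R.PosDef) (hS : S.PosSemidef) (Q : PSDMat r) {t : ℝ} (ht : 0 ≤ t) :
    (phi A R S t Q).1 = hamNumer A R S Q.1 t * (hamDenom A R S Q.1 t)⁻¹ := by
  obtain ⟨p, hp, h⟩ := exists_isRiccatiSolution (A := A) hR hS Q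
  rw [← hp.eq_phi hR hS ht, h t ht]

/-- Decay of the transition matrix thus becomes growth of the Hamiltonian denominator. -/
lemma isTransitionMatrix_hamDenom (hR : R.PosDef) (hS : S.PosSemidef) (Q : PSDMat r) :
    IsTransitionMatrix A R S Q (fun t => ((hamDenom A R S Q.1 t)⁻¹)ᵀ) := by
  refine ⟨by simp [hamDenom_zero], fun t ht => ?_⟩
  rw [phi_eq_hamRatio hR hS Q ht]
  exact hasDerivWithinAt_hamDenom_inv_transpose Q.2 hR hS ht

end WellPosed

/-! ### Absorbing balls and existence of a contraction rate. -/

section Contraction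

open Set

variable {r : ℕ} {A R S V : Matrix (Fin r) (Fin r) ℝ} {n c : ℝ}

/-- `X ↦ tr (V X)` is a Lyapunov function of the Riccati drift on the positive semi-definite
cone. -/
def RiccatiDrift (A R S V : Matrix (Fin r) (Fin r) ℝ) (n c : ℝ) : Prop :=
  ∀ X : Matrix (Fin r) (Fin r) ℝ, X.PosSemidef →
    (V * ricc A R S X).trace ≤ c - n * (V * X).trace

/-- The linear functional `X ↦ tr (V X)`. -/
def traceMulLin (V : Matrix (Fin r) (Fin r) ℝ) : Matrix (Fin r) (Fin r) ℝ →ₗ[ℝ] ℝ :=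
  (Matrix.traceLinearMap (Fin r) ℝ ℝ).comp (LinearMap.mulLeft ℝ V)

/-- Gronwall applied to `tr(V p) - c/n`. The curve is arbitrary so that it may also solve a
perturbed equation. -/
lemma trace_le_of_deriv_le {p : ℝ → PSDMat r} {p' : ℝ → Matrix (Fin r) (Fin r) ℝ} (hn : 0 < n)
    (hc : 0 ≤ c) (hp : ∀ t, 0 ≤ t → HasDerivWithinAt (fun s => (p s).1) (p' t) (Ici 0) t)
    (hd : ∀ t, 0 ≤ t → (V * p' t).trace ≤ c - n * (V * (p t).1).trace) {t : ℝ} (ht : 0 ≤ t) :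
    (V * (p t).1).trace ≤ (V * (p 0).1).trace * Real.exp (-n * t) + c / n := by
  have h := le_mul_exp_of_deriv_le (h := fun t => (V * (p t).1).trace - c / n)
    (h' := fun t => (V * p' t).trace) (a := 0) (k := -n)
    (fun t ht => ((hp t ht).linearMap_comp (traceMulLin V)).sub_const _)
    (fun t ht => by
      have := hd t ht
      have h2 : n * (c / n) = c := by field_simp
      linarith) ht
  simp only [sub_zero] at h
  have : 0 ≤ c / n * Real.exp (-n * t) := by positivity
  linarith

/-- Trajectories of a dissipative system are bounded, and eventually bounded by a constant which
does not depend on the initial condition. -/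
lemma exists_eventual_bound (hV : V.PosDef) (hn : 0 < n) (hc : 0 ≤ c) :
    ∃ b : ℝ, 0 < b ∧ ∀ q : ℝ, ∃ a T : ℝ, b ≤ a ∧ 0 ≤ T ∧ ∀ p : ℝ → PSDMat r, ‖(p 0).1‖ ≤ q →
      (∀ t, 0 ≤ t →
        (V * (p t).1).trace ≤ (V * (p 0).1).trace * Real.exp (-n * t) + c / n) →
      (∀ t, 0 ≤ t → ‖(p t).1‖ ≤ a) ∧ ∀ t, T ≤ t → ‖(p t).1‖ ≤ b := by
  obtain ⟨k, hk, htr⟩ := hV.exists_trace_le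
  refine ⟨k * (1 + c / n), by positivity, fun q => ?_⟩
  set m : ℝ := ‖V‖ * (r * |q|) with hm
  have hm0 : 0 ≤ m := by positivity
  -- `m` dominates the initial value of `tr(V p)`; after time `m / n` its contribution is at most `m
  -- exp(-m) ≤ 1`, hence the `1` in `b`.
  refine ⟨k * (m + 1 + c / n), m / n, by gcongr; linarith, by positivity, fun p hq hp => ?_⟩
  have h0 : (V * (p 0).1).trace ≤ m := by
    refine (le_abs_self _).trans (((p 0).2.abs_trace_mul_le V).trans ?_)
    have : (p 0).1.trace ≤ r * ‖(p 0).1‖ := by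
      simpa using Matrix.PosSemidef.trace_le_mul_l2_opNorm (X := (p 0).1)
    rw [hm]
    gcongr
    exact this.trans (by gcongr; exact hq.trans (le_abs_self q))
  have key : ∀ t, 0 ≤ t → ‖(p t).1‖ ≤ k * (m * Real.exp (-n * t) + c / n) := fun t ht =>
    calc ‖(p t).1‖ ≤ (p t).1.trace := (p t).2.l2_opNorm_le_trace
      _ ≤ k * (V * (p t).1).trace := htr _ (p t).2
      _ ≤ k * (m * Real.exp (-n * t) + c / n) := by
          gcongr
          refine (hp t ht).trans ?_
          gcongr
  refine ⟨fun t ht => (key t ht).trans ?_, fun t ht => ?_⟩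
  · have : Real.exp (-n * t) ≤ 1 := Real.exp_le_one_iff.2 (by nlinarith)
    gcongr
    nlinarith
  · refine (key t (le_trans (by positivity) ht)).trans ?_
    gcongr
    have h1 : Real.exp (-n * t) ≤ Real.exp (-m) := by
      gcongr
      rw [div_le_iff₀ hn] at ht
      linarith
    calc m * Real.exp (-n * t) ≤ Real.exp m * Real.exp (-m) := by
          gcongr
          linarith [Real.add_one_le_exp m]
      _ = 1 := by rw [← Real.exp_add]; simp

lemma trace_phi_le (hR : R.PosDef) (hS : S.PosSemidef) (hn : 0 < n) (hc : 0 ≤ c)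
    (hd : RiccatiDrift A R S V n c) (Q : PSDMat r) {t : ℝ} (ht : 0 ≤ t) :
    (V * (phi A R S t Q).1).trace ≤
      (V * (phi A R S 0 Q).1).trace * Real.exp (-n * t) + c / n :=
  trace_le_of_deriv_le (p := fun t => phi A R S t Q) hn hc
    (fun t ht => (isRiccatiSolution_phi hR hS Q).2 t ht)
    (fun t _ => hd _ (phi A R S t Q).2) ht

lemma hamNumer_eq (hR : R.PosDef) (hS : S.PosSemidef) (Q : PSDMat r) {t : ℝ} (ht : 0 ≤ t) :
    hamNumer A R S Q.1 t = (phi A R S t Q).1 * hamDenom A R S Q.1 t := by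
  rw [phi_eq_hamRatio hR hS Q ht, Matrix.mul_assoc, Matrix.nonsing_inv_mul, Matrix.mul_one]
  exact (Matrix.isUnit_iff_isUnit_det _).1 (isUnit_hamDenom Q.2 hR hS ht)

lemma hasDerivWithinAt_hamDenom_normSq (hR : R.PosDef) (hS : S.PosSemidef) (Q : PSDMat r)
    (x : Fin r → ℝ) {t : ℝ} (ht : 0 ≤ t) (s : Set ℝ) :
    HasDerivWithinAt (fun t => (hamDenom A R S Q.1 t *ᵥ x) ⬝ᵥ (hamDenom A R S Q.1 t *ᵥ x))
      (2 * ((hamDenom A R S Q.1 t *ᵥ x) ⬝ᵥ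
        ((S * (phi A R S t Q).1 - Aᵀ) *ᵥ (hamDenom A R S Q.1 t *ᵥ x)))) s t := by
  have h := hasDerivWithinAt_hamDenom (A := A) (R := R) (S := S) (Q := Q.1) s t
  have h2 := (h.matrix_transpose.mul h).linearMap_comp (quadFormLin x)
  have e : ∀ M N : Matrix (Fin r) (Fin r) ℝ, quadFormLin x (Mᵀ * N) =
      (M *ᵥ x) ⬝ᵥ (N *ᵥ x) := fun M N => by
    have := dotProduct_transpose_mul_mul_mulVec M N 1 x
    rwa [Matrix.mul_one, Matrix.one_mulVec] at this
  simp only [Pi.mul_apply, e, map_add] at h2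
  refine h2.congr_deriv ?_
  rw [hamNumer_eq hR hS Q ht, ← Matrix.mul_assoc, ← Matrix.sub_mul, ← Matrix.mulVec_mulVec,
    dotProduct_comm, two_mul]

lemma neg_mul_le_dotProduct_mulVec (M : Matrix (Fin r) (Fin r) ℝ) {K : ℝ} (hK : ‖M‖ ≤ K)
    (x : Fin r → ℝ) : -K * (x ⬝ᵥ x) ≤ x ⬝ᵥ (M *ᵥ x) := by
  have h := neg_le_of_abs_le (abs_dotProduct_mulVec_le M x)
  have : 0 ≤ x ⬝ᵥ x := dotProduct_self_star_nonneg x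
  nlinarith

/-- Exponential growth of the denominator of the Hamiltonian system, with a rate which depends
only on the eventual bound `b` on the flow. -/
lemma hamDenom_growth (hR : R.PosDef) (hS : S.PosSemidef) {ρ : ℝ} (hρ : 0 < ρ)
    (hRρ : ∀ x : Fin r → ℝ, ρ * (x ⬝ᵥ x) ≤ x ⬝ᵥ (R *ᵥ x)) {b : ℝ} (hb : 0 < b) :
    ∃ k : ℝ, 0 < k ∧ ∀ a T : ℝ, b ≤ a → 0 ≤ T → ∃ m : ℝ, 0 < m ∧ ∀ Q : PSDMat r,
      (∀ t, 0 ≤ t → ‖(phi A R S t Q).1‖ ≤ a) → (∀ t, T ≤ t → ‖(phi A R S t Q).1‖ ≤ b) →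
      ∀ (x : Fin r → ℝ) (t : ℝ), 0 ≤ t → m * Real.exp (k * t) * (x ⬝ᵥ x) ≤
        (hamDenom A R S Q.1 t *ᵥ x) ⬝ᵥ (hamDenom A R S Q.1 t *ᵥ x) := by
  set K : ℝ := ‖S‖ * b + ‖A‖ with hK
  have hK0 : 0 ≤ K := by positivity
  -- The growing quantity will be `f + ε v`, with `f` the increasing form and `v = |W x|²`. This `ε`
  -- lets the possible loss `2Kεv` cost at most half of the gain `ρ v` coming from `R`.
  set ε : ℝ := ρ / (4 * K + 4) with hε
  have hε0 : 0 < ε := by positivity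
  have hεK : 2 * K * ε ≤ ρ / 2 := by
    rw [hε, mul_div_assoc', div_le_div_iff₀ (by positivity) (by positivity)]
    nlinarith
  -- Chosen so that `f + ε v ≤ (b + ε) v` turns the net gain `(ρ/2) v` into `k (f + ε v)`.
  set k : ℝ := ρ / 2 / (b + ε) with hk
  have hk0 : 0 < k := by positivity
  refine ⟨k, hk0, fun a T hba hT => ?_⟩
  set L : ℝ := ‖S‖ * a + ‖A‖ with hL
  have hL0 : 0 ≤ L := by have := hb.le.trans hba; positivity
  refine ⟨ε / (b + ε) * Real.exp (-2 * L * T) * Real.exp (-k * T), by positivity,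
    fun Q ha hbT x t ht => ?_⟩
  set v : ℝ → ℝ := fun t => (hamDenom A R S Q.1 t *ᵥ x) ⬝ᵥ (hamDenom A R S Q.1 t *ᵥ x) with hv
  set f : ℝ → ℝ := fun t => (hamDenom A R S Q.1 t *ᵥ x) ⬝ᵥ (hamNumer A R S Q.1 t *ᵥ x) with hf
  have hv0 : ∀ t, 0 ≤ v t := fun t => dotProduct_self_star_nonneg _
  have hx0 : v 0 = x ⬝ᵥ x := by simp [hv, hamDenom_zero]
  have hf0 : ∀ t, 0 ≤ t → 0 ≤ f t := fun t ht => hamForm_nonneg Q.2 hR hS x ht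
  have hfb : ∀ t, T ≤ t → f t ≤ b * v t := fun t htT => by
    simp only [hf, hv]
    rw [hamNumer_eq hR hS Q (hT.trans htT), ← Matrix.mulVec_mulVec]
    refine (le_abs_self _).trans ((abs_dotProduct_mulVec_le _ _).trans ?_)
    exact mul_le_mul_of_nonneg_right (hbT t htT) (hv0 t)
  have hnorm : ∀ t B, ‖(phi A R S t Q).1‖ ≤ B → ‖S * (phi A R S t Q).1 - Aᵀ‖ ≤ ‖S‖ * B + ‖A‖ := by
    intro t B h
    refine (norm_sub_le _ _).trans (add_le_add ((norm_mul_le _ _).trans ?_)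
      (l2_opNorm_transpose A).le)
    gcongr
  -- Before `T` only the larger bound `a` is known; it still prevents `v` from decaying faster than
  -- `exp(-2Lt)`.
  have hgrow : ∀ t, 0 ≤ t → v 0 * Real.exp (-2 * L * (t - 0)) ≤ v t := fun t ht =>
    mul_exp_le_of_le_deriv
      (fun t ht => hasDerivWithinAt_hamDenom_normSq hR hS Q x ht _)
      (fun t ht => by
        have := neg_mul_le_dotProduct_mulVec _ (hnorm t a (ha t ht)) (hamDenom A R S Q.1 t *ᵥ x)
        rw [← hL] at this
        change -2 * L * (_ ⬝ᵥ _) ≤ _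
        linarith) ht
  have hεb : ε / (b + ε) ≤ 1 := by rw [div_le_one (by positivity)]; linarith
  rcases le_total t T with htT | htT
  · have e1 : Real.exp (-2 * L * T) ≤ Real.exp (-2 * L * (t - 0)) :=
      Real.exp_le_exp.2 (by nlinarith)
    have e2 : Real.exp (k * (t - T)) ≤ 1 := Real.exp_le_one_iff.2 (by nlinarith)
    calc ε / (b + ε) * Real.exp (-2 * L * T) * Real.exp (-k * T) * Real.exp (k * t) * (x ⬝ᵥ x)
        = ε / (b + ε) * Real.exp (-2 * L * T) * Real.exp (k * (t - T)) * v 0 := by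
          rw [mul_assoc (ε / (b + ε) * Real.exp (-2 * L * T)), ← Real.exp_add, hx0]; ring_nf
      _ ≤ 1 * Real.exp (-2 * L * (t - 0)) * 1 * v 0 := by
          gcongr
          exact hv0 0
      _ ≤ v t := by linarith [hgrow t ht]
  · have hw : (f T + ε * v T) * Real.exp (k * (t - T)) ≤ f t + ε * v t := by
      refine mul_exp_le_of_le_deriv (h := fun t => f t + ε * v t)
        (fun s hs => (hasDerivWithinAt_hamForm hS.isSymm x _ s).add
          ((hasDerivWithinAt_hamDenom_normSq hR hS Q x (hT.trans hs) _).const_mul ε))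
        (fun s hs => ?_) htT
      have h1 := neg_mul_le_dotProduct_mulVec _ (hnorm s b (hbT s hs)) (hamDenom A R S Q.1 s *ᵥ x)
      have h2 := hRρ (hamDenom A R S Q.1 s *ᵥ x)
      have h3 := hS.dotProduct_nonneg (hamNumer A R S Q.1 s *ᵥ x)
      have h4 := hfb s hs
      have h5 : k * (f s + ε * v s) ≤ ρ / 2 * v s := by
        calc k * (f s + ε * v s) ≤ k * ((b + ε) * v s) := by gcongr; linarith
          _ = ρ / 2 * v s := by rw [hk]; field_simp
      have h6 : 2 * K * ε * v s ≤ ρ / 2 * v s := mul_le_mul_of_nonneg_right hεK (hv0 s)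
      have h7 := mul_le_mul_of_nonneg_left h1 (mul_nonneg zero_le_two hε0.le)
      simp only [hv] at *
      linarith
    have h1 := hfb t htT
    have h2 := hf0 T hT
    have h3 := hgrow T hT
    rw [sub_zero, hx0] at h3
    calc ε / (b + ε) * Real.exp (-2 * L * T) * Real.exp (-k * T) * Real.exp (k * t) * (x ⬝ᵥ x)
        = ε * (x ⬝ᵥ x * Real.exp (-2 * L * T)) * Real.exp (k * (t - T)) / (b + ε) := by
          rw [mul_assoc (ε / (b + ε) * Real.exp (-2 * L * T)), ← Real.exp_add]; ring_nf
      _ ≤ (f T + ε * v T) * Real.exp (k * (t - T)) / (b + ε) := by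
          gcongr
          nlinarith
      _ ≤ v t := by
          rw [div_le_iff₀ (by positivity)]
          linarith

lemma exists_isContractionRate (hR : R.PosDef) (hS : S.PosSemidef) (hV : V.PosDef) (hn : 0 < n)
    (hc : 0 ≤ c) (hd : RiccatiDrift A R S V n c) : ∃ ν, IsContractionRate A R S ν := by
  obtain ⟨ρ, hρ, hRρ⟩ := hR.exists_pos_mul_le
  obtain ⟨b, hb, hbound⟩ := exists_eventual_bound hV hn hc
  obtain ⟨k, hk, hgrow⟩ := hamDenom_growth (A := A) hR hS hρ hRρ hb
  -- The squared norm of the inverse decays like `exp(-kt)`, so the norm decays like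
  -- `exp(-2(k/4)t)`.
  have key : ∀ q : ℝ, ∃ C : ℝ, 0 ≤ C ∧ ∀ Q : PSDMat r, ‖Q.1‖ ≤ q → ∀ t, 0 ≤ t →
      ‖((hamDenom A R S Q.1 t)⁻¹)ᵀ‖ ≤ C * Real.exp (-2 * (k / 4) * t) := by
    intro q
    obtain ⟨a, T, hba, hT, h⟩ := hbound q
    obtain ⟨m, hm, hmg⟩ := hgrow a T hba hT
    refine ⟨√(m⁻¹), Real.sqrt_nonneg _, fun Q hQ t ht => ?_⟩
    obtain ⟨h1, h2⟩ := h (fun t => phi A R S t Q) (by simpa only [phi_zero hR hS] using hQ)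
      (fun t ht => trace_phi_le hR hS hn hc hd Q ht)
    rw [l2_opNorm_transpose]
    refine l2_opNorm_le_of_mulVec _ (by positivity) fun z => ?_
    have h3 := hmg Q h1 h2 ((hamDenom A R S Q.1 t)⁻¹ *ᵥ z) t ht
    rw [Matrix.mulVec_mulVec z, Matrix.mul_nonsing_inv _
      ((Matrix.isUnit_iff_isUnit_det _).1 (isUnit_hamDenom Q.2 hR hS ht)), Matrix.one_mulVec] at h3
    rw [mul_pow, Real.sq_sqrt (by positivity), ← Real.exp_nat_mul, mul_assoc,
      le_inv_mul_iff₀ hm]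
    have e : Real.exp (k * t) * Real.exp ((2 : ℕ) * (-2 * (k / 4) * t)) = 1 := by
      rw [← Real.exp_add, Real.exp_eq_one_iff]; push_cast; ring
    calc _ = (m * Real.exp (k * t) * (((hamDenom A R S Q.1 t)⁻¹ *ᵥ z) ⬝ᵥ
          ((hamDenom A R S Q.1 t)⁻¹ *ᵥ z))) * Real.exp ((2 : ℕ) * (-2 * (k / 4) * t)) := by
          linear_combination (-m * (((hamDenom A R S Q.1 t)⁻¹ *ᵥ z) ⬝ᵥ
            ((hamDenom A R S Q.1 t)⁻¹ *ᵥ z))) * e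
      _ ≤ z ⬝ᵥ z * Real.exp ((2 : ℕ) * (-2 * (k / 4) * t)) := by gcongr
      _ = _ := mul_comm _ _
  choose C hC0 hC using key
  -- The chosen `C` need not be monotone in `q`; sums of nonnegative values over integers up to
  -- `⌈q⌉₊` are.
  refine ⟨k / 4, by positivity, fun q => ∑ i ∈ Finset.range (⌈q⌉₊ + 1), C i, fun q _ q' _ h => ?_,
    fun Q => ⟨_, isTransitionMatrix_hamDenom hR hS Q, fun t ht => ?_⟩⟩
  · refine Finset.sum_le_sum_of_subset_of_nonneg ?_ fun i _ _ => hC0 i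
    exact Finset.range_mono (by gcongr)
  · refine (hC ⌈‖Q.1‖⌉₊ Q (Nat.le_ceil _) t ht).trans ?_
    gcongr
    exact Finset.single_le_sum (f := fun i : ℕ => C i) (fun i _ => hC0 i)
      (Finset.mem_range.2 (Nat.lt_succ_self _))

end Contraction

/-! ### Fixed points and stability of the flow under perturbations. -/

section Perturbation

open Set Filter Topology

variable {r : ℕ} {A R S V : Matrix (Fin r) (Fin r) ℝ} {n c ν : ℝ}

/-- Each of the two conjugating transition matrices contributes `exp(-2νt)`. Truncating `κ` at zero
makes it nonnegative without losing monotonicity. -/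
lemma IsContractionRate.exists_lipschitz (hR : R.PosDef) (hS : S.PosSemidef)
    (hν : IsContractionRate A R S ν) :
    ∃ κ : ℝ → ℝ, MonotoneOn κ (Ici 0) ∧ (∀ q, 0 ≤ κ q) ∧
      ∀ (Q₁ Q₂ : PSDMat r) (t : ℝ), 0 ≤ t → ‖(phi A R S t Q₁).1 - (phi A R S t Q₂).1‖ ≤
        κ ‖Q₁.1‖ * κ ‖Q₂.1‖ * Real.exp (-4 * ν * t) * ‖Q₁.1 - Q₂.1‖ := by
  obtain ⟨-, κ, hmono, h⟩ := hν
  refine ⟨fun q => max (κ q) 0, fun x hx y hy hxy => max_le_max (hmono hx hy hxy) le_rfl,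
    fun q => le_max_right _ _, fun Q₁ Q₂ t ht => ?_⟩
  obtain ⟨E, hE, hEb⟩ := h Q₁
  obtain ⟨F, hF, hFb⟩ := h Q₂
  rw [phi_sub_phi hR hS hE hF ht]
  have hexp : Real.exp (-4 * ν * t) = Real.exp (-2 * ν * t) * Real.exp (-2 * ν * t) := by
    rw [← Real.exp_add]; ring_nf
  have h1 : ‖E t‖ ≤ max (κ ‖Q₁.1‖) 0 * Real.exp (-2 * ν * t) :=
    (hEb t ht).trans (by gcongr; exact le_max_left _ _)
  have h2 : ‖F t‖ ≤ max (κ ‖Q₂.1‖) 0 * Real.exp (-2 * ν * t) :=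
    (hFb t ht).trans (by gcongr; exact le_max_left _ _)
  calc ‖E t * (Q₁.1 - Q₂.1) * (F t)ᵀ‖ ≤ ‖E t‖ * ‖Q₁.1 - Q₂.1‖ * ‖F t‖ := by
        refine (norm_mul_le _ _).trans ?_
        rw [l2_opNorm_transpose]
        gcongr
        exact norm_mul_le _ _
    _ ≤ (max (κ ‖Q₁.1‖) 0 * Real.exp (-2 * ν * t)) * ‖Q₁.1 - Q₂.1‖ *
        (max (κ ‖Q₂.1‖) 0 * Real.exp (-2 * ν * t)) := by gcongr
    _ = _ := by rw [hexp]; ring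

/-- Letting `t → ∞` removes transients; this turns flow estimates into fixed point estimates. -/
lemma le_of_le_add_mul_exp {x d C : ℝ} (hν : 0 < ν)
    (h : ∀ t, 0 ≤ t → x ≤ d + C * Real.exp (-4 * ν * t)) : x ≤ d := by
  have h1 : Tendsto (fun t : ℝ => d + C * Real.exp (-4 * ν * t)) atTop (𝓝 (d + C * 0)) := by
    refine ((Real.tendsto_exp_atBot.comp ?_).const_mul C).const_add d
    exact tendsto_id.const_mul_atTop_of_neg (by linarith)
  have := ge_of_tendsto h1 ((eventually_ge_atTop 0).mono h)
  simpa using this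

lemma continuous_phi (hR : R.PosDef) (hS : S.PosSemidef) (hν : IsContractionRate A R S ν)
    {t : ℝ} (ht : 0 ≤ t) : Continuous (phi A R S t) := by
  obtain ⟨κ, hmono, hκ, hlip⟩ := hν.exists_lipschitz hR hS
  rw [continuous_induced_rng, continuous_iff_continuousAt]
  intro Q
  rw [ContinuousAt, tendsto_iff_norm_sub_tendsto_zero]
  have h1 : Tendsto (fun X : PSDMat r => ‖X.1 - Q.1‖) (𝓝 Q) (𝓝 0) :=
    tendsto_iff_norm_sub_tendsto_zero.1 continuous_subtype_val.continuousAt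
  have h2 : ∀ᶠ X : PSDMat r in 𝓝 Q, ‖X.1‖ < ‖Q.1‖ + 1 :=
    continuous_subtype_val.norm.continuousAt.eventually_lt continuousAt_const (by simp)
  have h3 := h1.const_mul (κ (‖Q.1‖ + 1) * κ ‖Q.1‖ * Real.exp (-4 * ν * t))
  rw [mul_zero] at h3
  refine squeeze_zero' (Eventually.of_forall fun _ => norm_nonneg _) ?_ h3
  filter_upwards [h2] with X hX
  refine (hlip X Q t ht).trans ?_
  gcongr
  · exact hκ _
  · exact hmono (norm_nonneg X.1) (show (0 : ℝ) ≤ ‖Q.1‖ + 1 by positivity) hX.le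

lemma isClosed_posSemidef : IsClosed {X : Matrix (Fin r) (Fin r) ℝ | X.PosSemidef} := by
  have : {X : Matrix (Fin r) (Fin r) ℝ | X.PosSemidef} =
      {X | Xᵀ = X} ∩ ⋂ x : Fin r → ℝ, {X | 0 ≤ x ⬝ᵥ (X *ᵥ x)} := by
    ext X
    simp only [mem_ofPred_eq, mem_inter_iff, mem_iInter]
    exact ⟨fun h => ⟨h.isSymm, h.dotProduct_nonneg⟩, fun h => posSemidef_of_isSymm h.1 h.2⟩
  rw [this]
  refine (isClosed_eq continuous_id.matrix_transpose continuous_id).inter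
    (isClosed_iInter fun x => isClosed_le continuous_const ?_)
  exact (quadFormLin x).continuous_of_finiteDimensional

lemma IsRiccatiFixedPoint.phi_eq (hR : R.PosDef) (hS : S.PosSemidef)
    {P : Matrix (Fin r) (Fin r) ℝ} (hP : IsRiccatiFixedPoint A R S P) {t : ℝ} (ht : 0 ≤ t) :
    phi A R S t ⟨P, hP.1.posSemidef⟩ = ⟨P, hP.1.posSemidef⟩ := by
  have : IsRiccatiSolution (fun X : PSDMat r => ricc A R S X.1) ⟨P, hP.1.posSemidef⟩
      (fun _ => ⟨P, hP.1.posSemidef⟩) :=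
    ⟨rfl, fun t _ => by simpa only [hP.2] using hasDerivWithinAt_const t (Ici (0 : ℝ)) P⟩
  exact (this.eq_phi hR hS ht).symm

/-- If `P x = 0`, every term of `x·Ricc(P) x` except `x·R x` vanishes, which forces `x = 0`. -/
lemma posDef_of_ricc_eq_zero (hR : R.PosDef) {P : Matrix (Fin r) (Fin r) ℝ}
    (hP : P.PosSemidef) (h : ricc A R S P = 0) : P.PosDef := by
  refine .of_dotProduct_mulVec_pos hP.isHermitian fun x hx => ?_
  rw [star_trivial]
  refine lt_of_le_of_ne (hP.dotProduct_nonneg x) fun h0 => ?_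
  have hPx : P *ᵥ x = 0 := (hP.dotProduct_mulVec_zero_iff x).1 (by simpa using h0.symm)
  have hxP : x ᵥ* P = 0 := by rw [← hP.isSymm, Matrix.vecMul_transpose, hPx]
  have h1 : x ⬝ᵥ (ricc A R S P *ᵥ x) = x ⬝ᵥ (R *ᵥ x) := by
    have e1 : (A * P) *ᵥ x = 0 := by rw [← Matrix.mulVec_mulVec, hPx, Matrix.mulVec_zero]
    have e2 : x ⬝ᵥ ((P * Aᵀ) *ᵥ x) = 0 := by
      rw [← Matrix.mulVec_mulVec, Matrix.dotProduct_mulVec, hxP, zero_dotProduct]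
    have e3 : (P * S * P) *ᵥ x = 0 := by rw [← Matrix.mulVec_mulVec, hPx, Matrix.mulVec_zero]
    simp only [ricc, Matrix.add_mulVec, Matrix.sub_mulVec, dotProduct_add, dotProduct_sub, e1, e2,
      e3, dotProduct_zero]
    ring
  have h2 := hR.dotProduct_mulVec_pos hx
  rw [star_trivial, ← h1, h] at h2
  simp at h2

/-- The orbit of `0` at integer times is Cauchy by contraction. Its limit is invariant because the
orbits of `0` and `φ_s(0)` merge, and an invariant point annihilates the drift. -/
lemma existsUnique_isRiccatiFixedPoint (hR : R.PosDef) (hS : S.PosSemidef)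
    (hν : IsContractionRate A R S ν) :
    ∃! P : Matrix (Fin r) (Fin r) ℝ, IsRiccatiFixedPoint A R S P := by
  obtain ⟨κ, hmono, hκ, hlip⟩ := hν.exists_lipschitz hR hS
  refine existsUnique_of_exists_of_unique ?_ fun P₁ P₂ h₁ h₂ => ?_
  · let Z : PSDMat r := ⟨0, .zero⟩
    have hdist : ∀ k : ℕ, ∀ s, 0 ≤ s →
        ‖(phi A R S k (phi A R S s Z)).1 - (phi A R S k Z).1‖ ≤
          κ ‖(phi A R S s Z).1‖ * κ ‖Z.1‖ * ‖(phi A R S s Z).1 - Z.1‖ *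
            Real.exp (-4 * ν) ^ k := fun k s _ => by
      refine (hlip _ _ k (Nat.cast_nonneg k)).trans_eq ?_
      rw [← Real.exp_nat_mul]; ring_nf
    have hexp : Real.exp (-4 * ν) < 1 := Real.exp_lt_one_iff.2 (by linarith [hν.1])
    have hcau : CauchySeq fun k : ℕ => (phi A R S k Z).1 := by
      refine cauchySeq_of_le_geometric (Real.exp (-4 * ν))
        (κ ‖(phi A R S 1 Z).1‖ * κ ‖Z.1‖ * ‖(phi A R S 1 Z).1 - Z.1‖) hexp fun k => ?_
      rw [dist_comm, dist_eq_norm, Nat.cast_add_one, add_comm, phi_add hR hS Z zero_le_one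
        (Nat.cast_nonneg k)]
      exact hdist k 1 zero_le_one
    obtain ⟨P, hP⟩ := cauchySeq_tendsto_of_complete hcau
    have hPpsd : P.PosSemidef :=
      isClosed_posSemidef.mem_of_tendsto hP (Eventually.of_forall fun k => (phi A R S k Z).2)
    have hP' : Tendsto (fun k : ℕ => phi A R S k Z) atTop (𝓝 ⟨P, hPpsd⟩) :=
      tendsto_subtype_rng.2 hP
    have hfix : ∀ s, 0 ≤ s → phi A R S s ⟨P, hPpsd⟩ = ⟨P, hPpsd⟩ := by
      intro s hs
      have h1 := ((continuous_phi hR hS hν hs).tendsto _).comp hP'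
      refine tendsto_nhds_unique h1 (tendsto_subtype_rng.2 ?_)
      have h2 : Tendsto (fun k : ℕ => (phi A R S k (phi A R S s Z)).1 - (phi A R S k Z).1) atTop
          (𝓝 0) := by
        refine squeeze_zero_norm (fun k => hdist k s hs) ?_
        have := (tendsto_pow_atTop_nhds_zero_of_lt_one (Real.exp_pos _).le hexp).const_mul
          (κ ‖(phi A R S s Z).1‖ * κ ‖Z.1‖ * ‖(phi A R S s Z).1 - Z.1‖)
        simpa using this
      have h3 := h2.add hP
      simp only [sub_add_cancel, zero_add] at h3
      refine h3.congr fun k => ?_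
      simp only [Function.comp]
      rw [← phi_add hR hS Z hs (Nat.cast_nonneg k), add_comm, phi_add hR hS Z (Nat.cast_nonneg k) hs]
    have hric : ricc A R S P = 0 := by
      have h1 := (isRiccatiSolution_phi (A := A) hR hS ⟨P, hPpsd⟩).2 0 le_rfl
      have h2 := (hasDerivWithinAt_const (0 : ℝ) (Ici (0 : ℝ)) P).congr
        (f₁ := fun s => (phi A R S s ⟨P, hPpsd⟩).1)
        (fun s hs => by rw [hfix s hs]) (by rw [hfix 0 le_rfl])
      have := (uniqueDiffOn_Ici (0 : ℝ) 0 self_mem_Ici).eq_deriv _ h1 h2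
      simpa only [hfix 0 le_rfl] using this
    exact ⟨P, posDef_of_ricc_eq_zero hR hPpsd hric, hric⟩
  · rw [← sub_eq_zero, ← norm_le_zero_iff]
    refine le_of_le_add_mul_exp (C := κ ‖P₁‖ * κ ‖P₂‖ * ‖P₁ - P₂‖) hν.1 fun t ht => ?_
    have := hlip ⟨P₁, h₁.1.posSemidef⟩ ⟨P₂, h₂.1.posSemidef⟩ t ht
    rw [h₁.phi_eq hR hS ht, h₂.phi_eq hR hS ht] at this
    linarith

/-- A nonlinear variation of constants estimate: a bounded trajectory of the perturbed equation
`p' = Ricc(p) + Δ` stays close to the Riccati flow. -/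
lemma norm_sub_phi_le_of_perturbation (hR : R.PosDef) (hS : S.PosSemidef) (hν : 0 < ν) {κ : ℝ → ℝ}
    (hmono : MonotoneOn κ (Ici 0)) (hκ : ∀ q, 0 ≤ κ q)
    (hlip : ∀ (Q₁ Q₂ : PSDMat r) (t : ℝ), 0 ≤ t →
      ‖(phi A R S t Q₁).1 - (phi A R S t Q₂).1‖ ≤
        κ ‖Q₁.1‖ * κ ‖Q₂.1‖ * Real.exp (-4 * ν * t) * ‖Q₁.1 - Q₂.1‖)
    {p : ℝ → PSDMat r} {Δ : ℝ → Matrix (Fin r) (Fin r) ℝ} {b g : ℝ}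
    (hp : ∀ t, 0 ≤ t →
      HasDerivWithinAt (fun s => (p s).1) (ricc A R S (p t).1 + Δ t) (Ici 0) t)
    (hb : ∀ t, 0 ≤ t → ‖(p t).1‖ ≤ b) (hg : ∀ t, 0 ≤ t → ‖Δ t‖ ≤ g) {t : ℝ} (ht : 0 ≤ t) :
    ‖(p t).1 - (phi A R S t (p 0)).1‖ ≤ κ (b + 1) ^ 2 * g / (4 * ν) := by
  have hb0 : 0 ≤ b := (norm_nonneg _).trans (hb 0 le_rfl)
  have hg0 : 0 ≤ g := (norm_nonneg _).trans (hg 0 le_rfl)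
  -- The margin `+ 1` is for the points `φ_{z-s}(p_s)`: they are near `p_s` for `z` close to `s`,
  -- but need not have norm at most `b`.
  set K := κ (b + 1) ^ 2 with hK
  have hK0 : 0 ≤ K := by positivity
  have hlip' : ∀ (Q₁ Q₂ : PSDMat r) (t : ℝ), 0 ≤ t → ‖Q₁.1‖ ≤ b + 1 → ‖Q₂.1‖ ≤ b + 1 →
      ‖(phi A R S t Q₁).1 - (phi A R S t Q₂).1‖ ≤
        K * Real.exp (-4 * ν * t) * ‖Q₁.1 - Q₂.1‖ := by
    intro Q₁ Q₂ t ht h1 h2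
    refine (hlip Q₁ Q₂ t ht).trans ?_
    rw [hK, sq]
    have h3 := hmono (norm_nonneg Q₁.1) (show (0 : ℝ) ≤ b + 1 by positivity) h1
    have h4 := hmono (norm_nonneg Q₂.1) (show (0 : ℝ) ≤ b + 1 by positivity) h2
    gcongr
    · exact hκ _
    · exact hκ _
  set u : ℝ → Matrix (Fin r) (Fin r) ℝ := fun s => (phi A R S (t - s) (p s)).1 with hu
  have hflow : ∀ Q : PSDMat r, ContinuousOn (fun s => (phi A R S s Q).1) (Ici 0) :=
    fun Q => (isRiccatiSolution_phi hR hS Q).continuousOn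
  have hpc : ContinuousOn (fun s => (p s).1) (Ici 0) := fun s hs => (hp s hs).continuousWithinAt
  have hucont : ContinuousOn u (Icc 0 t) := by
    intro s hs
    rw [ContinuousWithinAt, tendsto_iff_norm_sub_tendsto_zero]
    have h1 : Tendsto (fun z => ‖(p z).1 - (p s).1‖) (𝓝[Icc 0 t] s) (𝓝 0) :=
      tendsto_iff_norm_sub_tendsto_zero.1 ((hpc s hs.1).mono Icc_subset_Ici_self)
    have h2 : Tendsto (fun z => ‖(phi A R S (t - z) (p s)).1 - (phi A R S (t - s) (p s)).1‖)
        (𝓝[Icc 0 t] s) (𝓝 0) := by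
      refine tendsto_iff_norm_sub_tendsto_zero.1 ?_
      have : ContinuousOn (fun z => (phi A R S (t - z) (p s)).1) (Icc 0 t) :=
        (hflow (p s)).comp (continuousOn_const.sub continuousOn_id)
          (fun z hz => sub_nonneg.2 hz.2)
      exact this s hs
    have h3 := (h1.const_mul K).add h2
    rw [mul_zero, add_zero] at h3
    refine squeeze_zero' (Eventually.of_forall fun _ => norm_nonneg _) ?_ h3
    filter_upwards [self_mem_nhdsWithin] with z hz
    have h4 := hlip' (p z) (p s) (t - z) (sub_nonneg.2 hz.2) (by linarith [hb z hz.1])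
      (by linarith [hb s hs.1])
    have h5 : Real.exp (-4 * ν * (t - z)) ≤ 1 :=
      Real.exp_le_one_iff.2 (by nlinarith [mul_nonneg hν.le (sub_nonneg.2 hz.2)])
    calc ‖u z - u s‖ ≤ ‖(phi A R S (t - z) (p z)).1 - (phi A R S (t - z) (p s)).1‖ +
          ‖(phi A R S (t - z) (p s)).1 - (phi A R S (t - s) (p s)).1‖ :=
          norm_sub_le_norm_sub_add_norm_sub _ _ _
      _ ≤ K * ‖(p z).1 - (p s).1‖ + _ := by
          gcongr
          refine h4.trans ?_
          gcongr
          exact mul_le_of_le_one_right hK0 h5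
  -- By the semigroup law, `u z` and `u s` are images under the same map `φ_{t-z}` of `p_z` and
  -- `φ_{z-s}(p_s)`, which separate at velocity `Δ s`. The Lipschitz estimate suffices; no
  -- derivative in the initial condition is needed.
  have hslope : ∀ s ∈ Ico 0 t, ∀ ρ, K * Real.exp (-4 * ν * (t - s)) * g < ρ →
      ∃ᶠ z in 𝓝[>] s, slope (fun s => ‖u s - u 0‖) s z < ρ := by
    intro s hs ρ hρ
    refine Eventually.frequently ?_
    have hphi : HasDerivWithinAt (fun z => (phi A R S (z - s) (p s)).1)
        (ricc A R S (p s).1) (Ioi s) s := by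
      have h1 := (isRiccatiSolution_phi (A := A) hR hS (p s)).2 (s - s) (by simp)
      have h2 : HasDerivWithinAt (fun z : ℝ => z - s) 1 (Ioi s) s :=
        ((hasDerivAt_id s).sub_const s).hasDerivWithinAt
      have := h1.scomp (h := fun z => z - s) s h2 (fun z (hz : s < z) => sub_nonneg.2 hz.le)
      simpa [Function.comp_def, phi_zero hR hS] using this
    have hD : HasDerivWithinAt (fun z => (p z).1 - (phi A R S (z - s) (p s)).1) (Δ s) (Ioi s) s := by
      refine (((hp s hs.1).mono fun z (hz : s < z) => hs.1.trans hz.le).sub hphi).congr_deriv ?_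
      abel
    have hDslope := (hasDerivWithinAt_iff_tendsto_slope' self_notMem_Ioi).1 hD
    have hexp : Tendsto (fun z => K * Real.exp (-4 * ν * (t - z))) (𝓝[>] s)
        (𝓝 (K * Real.exp (-4 * ν * (t - s)))) := by
      refine Tendsto.mono_left (Continuous.tendsto ?_ s) nhdsWithin_le_nhds
      fun_prop
    have hlim := (hexp.mul hDslope.norm).eventually_lt_const (u := ρ)
      (lt_of_le_of_lt (by gcongr; exact hg s hs.1) hρ)
    have hphib : ∀ᶠ z in 𝓝[>] s, ‖(phi A R S (z - s) (p s)).1‖ < b + 1 := by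
      refine hphi.continuousWithinAt.norm.tendsto.eventually_lt_const ?_
      rw [sub_self, phi_zero hR hS]
      linarith [hb s hs.1]
    filter_upwards [hlim, hphib, Ioo_mem_nhdsGT hs.2] with z hz hzb hzI
    have hzs : 0 < z - s := sub_pos.2 hzI.1
    refine lt_of_le_of_lt ?_ hz
    have h1 : u s = (phi A R S (t - z) (phi A R S (z - s) (p s))).1 := by
      rw [← phi_add hR hS _ hzs.le (sub_nonneg.2 hzI.2.le)]
      simp only [hu]
      congr 2
      ring
    have h2 : ‖u z - u s‖ ≤ K * Real.exp (-4 * ν * (t - z)) *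
        ‖(p z).1 - (phi A R S (z - s) (p s)).1‖ := by
      rw [h1]
      exact hlip' _ _ _ (sub_nonneg.2 hzI.2.le) (by linarith [hb z (hs.1.trans hzI.1.le)]) hzb.le
    have h3 : ‖u z - u 0‖ - ‖u s - u 0‖ ≤ ‖u z - u s‖ := by
      refine (norm_sub_norm_le _ _).trans_eq ?_
      rw [sub_sub_sub_cancel_right]
    simp only [slope_def_module, sub_self, phi_zero hR hS, sub_zero, norm_smul, smul_eq_mul,
      Real.norm_eq_abs, abs_of_pos (inv_pos.2 hzs)]
    calc (z - s)⁻¹ * (‖u z - u 0‖ - ‖u s - u 0‖)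
        ≤ (z - s)⁻¹ * (K * Real.exp (-4 * ν * (t - z)) *
          ‖(p z).1 - (phi A R S (z - s) (p s)).1‖) := by
          gcongr
          exact h3.trans h2
      _ = _ := by ring
  -- The comparison theorem needs a strict inequality of derivatives, which `ε` supplies.
  have key : ∀ ε > 0, ‖(p t).1 - (phi A R S t (p 0)).1‖ ≤ K * g / (4 * ν) + ε := by
    intro ε hε
    have hB : ∀ s, HasDerivAt
        (fun s => (K * g / (4 * ν) + ε) * Real.exp (-4 * ν * (t - s)))
        ((K * g + 4 * ν * ε) * Real.exp (-4 * ν * (t - s))) s := by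
      intro s
      have h1 : HasDerivAt (fun s => Real.exp (-4 * ν * (t - s)))
          (Real.exp (-4 * ν * (t - s)) * (-4 * ν * -1)) s :=
        (((hasDerivAt_id s).const_sub t).const_mul (-4 * ν)).exp
      refine (h1.const_mul _).congr_deriv ?_
      field_simp
    have := image_le_of_liminf_slope_right_lt_deriv_boundary
      (f := fun s => ‖u s - u 0‖) (f' := fun s => K * Real.exp (-4 * ν * (t - s)) * g)
      (a := 0) (b := t) ((hucont.sub continuousOn_const).norm) hslope
      (B := fun s => (K * g / (4 * ν) + ε) * Real.exp (-4 * ν * (t - s)))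
      (by simp only [sub_self, norm_zero]; positivity) hB
      (fun s _ _ => by
        have h1 := Real.exp_pos (-4 * ν * (t - s))
        have h2 : 0 < 4 * ν * ε * Real.exp (-4 * ν * (t - s)) := by positivity
        linarith) ⟨ht, le_rfl⟩
    simpa [hu, phi_zero hR hS] using this
  exact le_of_forall_pos_le_add key

/-- Uniform comparison of the Riccati flow with dissipative perturbations of the equation. -/
lemma IsContractionRate.exists_perturbation_bound (hR : R.PosDef) (hS : S.PosSemidef)
    (hν : IsContractionRate A R S ν) (hV : V.PosDef) (hn : 0 < n) (hc : 0 ≤ c)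
    (hd : RiccatiDrift A R S V n c) :
    ∃ (χ₁ : ℝ) (χ₂ : ℝ → ℝ), ∀ (γ : ℝ) (p : ℝ → PSDMat r) (Δ : ℝ → Matrix (Fin r) (Fin r) ℝ),
      0 ≤ γ →
      (∀ t, 0 ≤ t →
        HasDerivWithinAt (fun s => (p s).1) (ricc A R S (p t).1 + Δ t) (Ici 0) t) →
      (∀ t, 0 ≤ t → (V * (ricc A R S (p t).1 + Δ t)).trace ≤ c - n * (V * (p t).1).trace) →
      (∀ t, 0 ≤ t → ‖Δ t‖ ≤ γ * (1 + ‖(p t).1‖) ^ 2) →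
      ∀ t, 0 ≤ t → ‖(p t).1 - (phi A R S t (p 0)).1‖ ≤
        (χ₁ + Real.exp (-4 * t * ν) * χ₂ ‖(p 0).1‖) * γ := by
  obtain ⟨κ, hmono, hκ, hlip⟩ := hν.exists_lipschitz hR hS
  have hν0 := hν.1
  obtain ⟨b, hb, hbound⟩ := exists_eventual_bound hV hn hc
  choose a T hab hT h using hbound
  set C : ℝ → ℝ := fun b => κ (b + 1) ^ 2 * (1 + b) ^ 2 / (4 * ν) with hC
  have hC0 : ∀ b, 0 ≤ C b := fun b => by positivity
  -- `C b` is the cost inside the absorbing ball. The `1` in `1 + κ b ^ 2` serves times before `T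
  -- q`, the `κ b ^ 2` later ones.
  refine ⟨C b, fun q => (1 + κ b ^ 2) * Real.exp (4 * ν * T q) * C (a q),
    fun γ p Δ hγ hp htr hΔ t ht => ?_⟩
  set q := ‖(p 0).1‖
  obtain ⟨hpa, hpb⟩ := h q p le_rfl fun t ht => trace_le_of_deriv_le hn hc hp htr ht
  obtain ⟨-, hfb⟩ := h q (fun t => phi A R S t (p 0)) (by simp only [phi_zero hR hS]; exact le_rfl)
    (fun t ht => trace_phi_le hR hS hn hc hd (p 0) ht)
  have ha0 : 0 ≤ a q := hb.le.trans (hab q)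
  have hfirst : ∀ t, 0 ≤ t → ‖(p t).1 - (phi A R S t (p 0)).1‖ ≤ C (a q) * γ := fun t ht => by
    refine (norm_sub_phi_le_of_perturbation hR hS hν0 hmono hκ hlip hp hpa
      (g := γ * (1 + a q) ^ 2) (fun t ht => (hΔ t ht).trans ?_) ht).trans_eq ?_
    · have := hpa t ht
      gcongr
    · simp only [hC]; ring
  rcases le_total t (T q) with htT | htT
  · have h1 : 1 ≤ Real.exp (-4 * t * ν) * Real.exp (4 * ν * T q) := by
      rw [← Real.exp_add, Real.one_le_exp_iff]
      nlinarith [mul_nonneg hν0.le (sub_nonneg.2 htT)]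
    refine (hfirst t ht).trans ?_
    gcongr
    calc C (a q) ≤ 0 + (Real.exp (-4 * t * ν) * Real.exp (4 * ν * T q)) * (1 + κ b ^ 2) * C (a q) := by
          rw [zero_add]
          refine le_mul_of_one_le_left (hC0 _) (one_le_mul_of_one_le_of_one_le h1 ?_)
          linarith [sq_nonneg (κ b)]
      _ ≤ _ := by
          rw [show ∀ x y z w : ℝ, x * (y * z * w) = x * z * y * w from fun _ _ _ _ => by ring]
          gcongr
          exact hC0 _
  -- Restart at `T q`: `p` stays within `C b * γ` of the flow from `p (T q)`, and that flow
  -- contracts towards the one from `φ_{T q}(p 0)`, since both restart in the ball of radius `b`.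
  · have hsub : 0 ≤ t - T q := sub_nonneg.2 htT
    have h1 : ‖(p t).1 - (phi A R S (t - T q) (p (T q))).1‖ ≤ C b * γ := by
      have hshift : ∀ s, 0 ≤ s → HasDerivWithinAt (fun s => (p (T q + s)).1)
          (ricc A R S (p (T q + s)).1 + Δ (T q + s)) (Ici 0) s := fun s hs => by
        have h1 := hp (T q + s) (add_nonneg (hT q) hs)
        have h2 : HasDerivWithinAt (fun u : ℝ => T q + u) 1 (Ici 0) s :=
          ((hasDerivAt_id s).const_add (T q)).hasDerivWithinAt
        have := h1.scomp s h2 (fun u (hu : 0 ≤ u) => add_nonneg (hT q) hu)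
        simpa [Function.comp_def] using this
      have := norm_sub_phi_le_of_perturbation hR hS hν0 hmono hκ hlip
        (p := fun s => p (T q + s)) (Δ := fun s => Δ (T q + s)) (b := b)
        (g := γ * (1 + b) ^ 2) hshift (fun s hs => hpb _ (by linarith))
        (fun s hs => (hΔ _ (add_nonneg (hT q) hs)).trans (by
          have := hpb (T q + s) (by linarith)
          gcongr)) hsub
      simp only [add_sub_cancel, add_zero] at this
      refine this.trans_eq ?_
      simp only [hC]; ring
    have h2 : ‖(phi A R S (t - T q) (p (T q))).1 - (phi A R S t (p 0)).1‖ ≤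
        κ b ^ 2 * Real.exp (-4 * ν * (t - T q)) * (C (a q) * γ) := by
      have e : phi A R S t (p 0) = phi A R S (t - T q) (phi A R S (T q) (p 0)) := by
        rw [← phi_add hR hS _ (hT q) hsub, add_sub_cancel]
      rw [e]
      refine (hlip _ _ _ hsub).trans ?_
      rw [sq]
      have h3 := hmono (norm_nonneg (p (T q)).1) (show (0 : ℝ) ≤ b from hb.le) (hpb _ le_rfl)
      have h4 := hmono (norm_nonneg (phi A R S (T q) (p 0)).1) (show (0 : ℝ) ≤ b from hb.le)
        (hfb _ le_rfl)
      have h5 := hκ b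
      have h6 := hκ ‖(phi A R S (T q) (p 0)).1‖
      gcongr
      exact hfirst _ (hT q)
    have e : Real.exp (-4 * ν * (t - T q)) = Real.exp (-4 * t * ν) * Real.exp (4 * ν * T q) := by
      rw [← Real.exp_add]; ring_nf
    have h3 : 0 ≤ Real.exp (-4 * t * ν) * Real.exp (4 * ν * T q) * C (a q) * γ :=
      mul_nonneg (mul_nonneg (by positivity) (hC0 _)) hγ
    rw [e] at h2
    refine (norm_sub_le_norm_sub_add_norm_sub _ (phi A R S (t - T q) (p (T q))).1 _).trans
      ((add_le_add h1 h2).trans ?_)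
    linear_combination h3

end Perturbation

/-! ### A Lyapunov function from observability. -/

section Observability

open Set

variable {r m : ℕ} {A R S V : Matrix (Fin r) (Fin r) ℝ}

lemma IsObservablePair.eq_zero {C : Matrix (Fin m) (Fin r) ℝ} (h : IsObservablePair A C)
    {x : Fin r → ℝ} (hx : ∀ k : ℕ, (C * A ^ k) *ᵥ x = 0) : x = 0 := by
  have h1 := LinearMap.finrank_range_add_finrank_ker (observabilityMatrix A C).mulVecLin
  have h2 : Module.finrank ℝ (LinearMap.range (observabilityMatrix A C).mulVecLin) = r := h
  rw [h2, Module.finrank_fin_fun, Nat.add_eq_left, Submodule.finrank_eq_zero,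
    LinearMap.ker_eq_bot] at h1
  refine h1 ?_
  rw [map_zero]
  funext ki
  exact congrFun (hx ki.1) ki.2

/-- The unobservable space of `B` is invariant under `B`, hence under `A = -B - 1`; the induction
therefore quantifies over `y`. -/
lemma mulVec_pow_eq_zero_of_shift {C : Matrix (Fin m) (Fin r) ℝ} {B : Matrix (Fin r) (Fin r) ℝ}
    (hB : A = -B - 1) (k : ℕ) : ∀ y : Fin r → ℝ, (∀ j : ℕ, (C * B ^ j) *ᵥ y = 0) →
      (C * A ^ k) *ᵥ y = 0 := by
  induction k with
  | zero => intro y hy; simpa using hy 0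
  | succ k ih =>
    intro y hy
    rw [pow_succ, ← Matrix.mul_assoc, ← Matrix.mulVec_mulVec]
    refine ih _ fun j => ?_
    have h1 := hy (j + 1)
    rw [pow_succ, ← Matrix.mul_assoc, ← Matrix.mulVec_mulVec] at h1
    rw [hB, Matrix.sub_mulVec, Matrix.neg_mulVec, Matrix.one_mulVec, Matrix.mulVec_sub,
      Matrix.mulVec_neg, h1, hy j]
    simp

/-- An orbit of a linear system which stays in the kernel of `C` over a time interval starts from
an unobservable state. -/
lemma mulVec_pow_eq_zero_of_exp {C : Matrix (Fin m) (Fin r) ℝ} {B : Matrix (Fin r) (Fin r) ℝ}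
    {x : Fin r → ℝ} (h : ∀ s ∈ Icc (0 : ℝ) 1, C *ᵥ (NormedSpace.exp (s • B) *ᵥ x) = 0) (k : ℕ) :
    (C * B ^ k) *ᵥ x = 0 := by
  -- Keeping all `s` in the interval allows the identity to be differentiated, each derivative
  -- producing one more factor `B`.
  have key : ∀ k : ℕ, ∀ s ∈ Icc (0 : ℝ) 1, (C * B ^ k * NormedSpace.exp (s • B)) *ᵥ x = 0 := by
    intro k
    induction k with
    | zero => intro s hs; simpa [← Matrix.mulVec_mulVec] using h s hs
    | succ k ih =>
      intro s hs
      let l : Matrix (Fin r) (Fin r) ℝ →ₗ[ℝ] (Fin m → ℝ) :=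
        { toFun := fun M => (C * B ^ k * M) *ᵥ x
          map_add' := fun M N => by rw [Matrix.mul_add, Matrix.add_mulVec]
          map_smul' := fun a M => by rw [Matrix.mul_smul, Matrix.smul_mulVec]; rfl }
      have h1 := ((hasDerivAt_exp_smul_const' (𝕂 := ℝ) B s).hasDerivWithinAt
        (s := Icc (0 : ℝ) 1)).linearMap_comp l
      have h2 := (hasDerivWithinAt_const s (Icc (0 : ℝ) 1) (0 : Fin m → ℝ)).congr
        (f₁ := fun u => l (NormedSpace.exp (u • B))) (fun u hu => ih u hu) (ih s hs)
      have h3 := (uniqueDiffOn_Icc zero_lt_one s hs).eq_deriv _ h1 h2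
      simpa [l, pow_succ, Matrix.mul_assoc] using h3
  simpa using key k 0 ⟨le_rfl, zero_le_one⟩

/-- The observability Gramian is positive definite and solves a Lyapunov inequality. -/
lemma exists_lyapunov {C : Matrix (Fin m) (Fin r) ℝ} {Sig : Matrix (Fin m) (Fin m) ℝ}
    (hSig : Sig.PosDef) (hS : S = Cᵀ * Sig⁻¹ * C) (hobs : IsObservablePair A C) :
    ∃ V : Matrix (Fin r) (Fin r) ℝ, V.PosDef ∧
      (S - (2 : ℝ) • V - (Aᵀ * V + V * A)).PosSemidef := by
  have hform : ∀ y, y ⬝ᵥ (S *ᵥ y) = (C *ᵥ y) ⬝ᵥ (Sig⁻¹ *ᵥ (C *ᵥ y)) := fun y => by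
    rw [hS, Matrix.mul_assoc, ← Matrix.mulVec_mulVec, Matrix.dotProduct_mulVec,
      Matrix.vecMul_transpose, ← Matrix.mulVec_mulVec]
  have hSpsd : S.PosSemidef := by
    rw [hS, ← Matrix.conjTranspose_eq_transpose_of_trivial]
    exact hSig.inv.posSemidef.conjTranspose_mul_mul_same C
  -- Reversing time gives the right sign of `AᵀV + VA`, and the shift by `-1` creates the decay term
  -- `2V`. The horizon is finite, so no stability of `A` is required.
  set B : Matrix (Fin r) (Fin r) ℝ := -A - 1 with hB
  have hAB : A = -B - 1 := by rw [hB]; abel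
  set G : ℝ → Matrix (Fin r) (Fin r) ℝ := fun s =>
    (NormedSpace.exp (s • B))ᵀ * S * NormedSpace.exp (s • B) with hG
  have hexp : ∀ s, HasDerivAt (fun s : ℝ => NormedSpace.exp (s • B))
      (NormedSpace.exp (s • B) * B) s := fun s => hasDerivAt_exp_smul_const (𝕂 := ℝ) B s
  have hGd : ∀ s, HasDerivAt G (Bᵀ * G s + G s * B) s := fun s => by
    rw [← hasDerivWithinAt_univ]
    refine ((((hexp s).hasDerivWithinAt.matrix_transpose).mul_const S).mul
      (hexp s).hasDerivWithinAt).congr_deriv ?_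
    simp only [hG, Matrix.transpose_mul]
    noncomm_ring
  have hGc : Continuous G := continuous_iff_continuousAt.2 fun s => (hGd s).continuousAt
  have hGi : IntervalIntegrable G MeasureTheory.volume 0 1 := hGc.intervalIntegrable 0 1
  set V : Matrix (Fin r) (Fin r) ℝ := ∫ s in (0 : ℝ)..1, G s with hV
  have hlin : ∀ {F : Type} [NormedAddCommGroup F] [NormedSpace ℝ F] [CompleteSpace F]
      (l : Matrix (Fin r) (Fin r) ℝ →ₗ[ℝ] F), l V = ∫ s in (0 : ℝ)..1, l (G s) := by
    intro F _ _ _ l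
    exact ((LinearMap.toContinuousLinearMap l).intervalIntegral_comp_comm hGi).symm
  have hGpsd : ∀ s, (G s).PosSemidef := fun s => hSpsd.transpose_mul_mul _
  have hVsymm : Vᵀ = V := by
    have := hlin (Matrix.transposeLinearEquiv (Fin r) (Fin r) ℝ ℝ).toLinearMap
    change Vᵀ = ∫ s in (0 : ℝ)..1, (G s)ᵀ at this
    rw [this]
    simp only [(hGpsd _).isSymm, hV]
  have hVpos : ∀ x : Fin r → ℝ, x ≠ 0 → 0 < x ⬝ᵥ (V *ᵥ x) := by
    intro x hx
    have h1 : x ⬝ᵥ (V *ᵥ x) = ∫ s in (0 : ℝ)..1, x ⬝ᵥ (G s *ᵥ x) := hlin (quadFormLin x)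
    rw [h1]
    refine intervalIntegral.integral_pos zero_lt_one
      ((quadFormLin x).continuous_of_finiteDimensional.comp hGc).continuousOn
      (fun s _ => (hGpsd s).dotProduct_nonneg x) ?_
    -- A Gramian form vanishing on all of `[0, 1]` means `C exp(sB) x = 0` there, by definiteness of
    -- `Sig⁻¹`.
    by_contra! hcon
    refine hx (hobs.eq_zero fun k => mulVec_pow_eq_zero_of_shift hAB k x
      (mulVec_pow_eq_zero_of_exp fun s hs => ?_))
    have h2 := le_antisymm (hcon s hs) ((hGpsd s).dotProduct_nonneg x)
    rw [hG, dotProduct_transpose_mul_mul_mulVec, hform] at h2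
    by_contra hne
    have := hSig.inv.dotProduct_mulVec_pos hne
    rw [star_trivial, h2] at this
    exact lt_irrefl _ this
  have hVeq : Bᵀ * V + V * B = G 1 - G 0 := by
    have h1 := hlin (LinearMap.mulLeft ℝ Bᵀ + LinearMap.mulRight ℝ B)
    change Bᵀ * V + V * B = ∫ s in (0 : ℝ)..1, (Bᵀ * G s + G s * B) at h1
    rw [h1]
    exact intervalIntegral.integral_eq_sub_of_hasDerivAt (fun s _ => hGd s)
      (((continuous_const.mul hGc).add (hGc.mul continuous_const)).intervalIntegrable 0 1)
  refine ⟨V, .of_dotProduct_mulVec_pos ?_ (by simpa using hVpos), ?_⟩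
  · rwa [Matrix.IsHermitian, Matrix.conjTranspose_eq_transpose_of_trivial]
  · have h0 : G 0 = S := by simp [hG]
    have : S - (2 : ℝ) • V - (Aᵀ * V + V * A) = G 1 := by
      rw [h0] at hVeq
      rw [eq_add_of_sub_eq hVeq.symm, hB]
      simp only [Matrix.transpose_sub, Matrix.transpose_neg, Matrix.transpose_one, two_smul]
      noncomm_ring
    rw [this]
    exact hGpsd 1

/-- The square `(X - V⁻¹/2) S (X - V⁻¹/2)` has nonnegative trace against `V`, so `tr(VXSX) ≥ tr(SX)
- tr(SV⁻¹)/4`. The quadratic damping becomes the linear term `-S X` that the Lyapunov inequality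
needs. -/
lemma trace_mul_ricc_le (hV : V.PosDef) (hS : S.PosSemidef) {X : Matrix (Fin r) (Fin r) ℝ}
    (hX : X.PosSemidef) :
    (V * ricc A R S X).trace ≤
      ((Aᵀ * V + V * A - S) * X).trace + (1 / 4) * (S * V⁻¹).trace + (R * V).trace := by
  set W := V⁻¹ with hW
  have hVW : V * W = 1 :=
    Matrix.mul_nonsing_inv _ ((Matrix.isUnit_iff_isUnit_det _).1 hV.isUnit)
  have hWV : W * V = 1 :=
    Matrix.nonsing_inv_mul _ ((Matrix.isUnit_iff_isUnit_det _).1 hV.isUnit)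
  have hY : (X - (1 / 2 : ℝ) • W)ᵀ = X - (1 / 2 : ℝ) • W := by
    rw [Matrix.transpose_sub, Matrix.transpose_smul, hX.isSymm, hV.inv.posSemidef.isSymm]
  have h0 := hV.posSemidef.trace_mul_nonneg (hS.transpose_mul_mul (X - (1 / 2 : ℝ) • W))
  have e1 : V * ((X - (1 / 2 : ℝ) • W)ᵀ * S * (X - (1 / 2 : ℝ) • W)) =
      V * X * S * X - (1 / 2 : ℝ) • (S * X) - (1 / 2 : ℝ) • (V * X * S * W) +
        (1 / 4 : ℝ) • (S * W) := by
    rw [hY]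
    simp only [sub_mul, mul_sub, smul_mul_assoc, mul_smul_comm, ← mul_assoc, hVW, one_mul]
    module
  have e2 : (V * X * S * W).trace = (S * X).trace := by
    rw [Matrix.trace_mul_comm, ← mul_assoc, ← mul_assoc, hWV, one_mul, Matrix.trace_mul_comm]
  have e3 : (V * (X * Aᵀ)).trace = (Aᵀ * V * X).trace := by
    rw [← mul_assoc, Matrix.trace_mul_comm, mul_assoc]
  have e4 : (V * R).trace = (R * V).trace := Matrix.trace_mul_comm _ _
  rw [e1, Matrix.trace_add, Matrix.trace_sub, Matrix.trace_sub, Matrix.trace_smul,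
    Matrix.trace_smul, Matrix.trace_smul, e2] at h0
  simp only [smul_eq_mul] at h0
  simp only [ricc, mul_add, mul_sub, add_mul, sub_mul, Matrix.trace_add, Matrix.trace_sub, e4,
    ← mul_assoc] at *
  linarith

/-- The Lyapunov function of an observable model is also one for the neighbouring models. -/
lemma exists_uniform_riccatiDrift (hV : V.PosDef)
    (hlyap : (S - (2 : ℝ) • V - (Aᵀ * V + V * A)).PosSemidef) :
    ∃ c η : ℝ, 0 ≤ c ∧ 0 < η ∧ ∀ A₁ R₁ S₁ : Matrix (Fin r) (Fin r) ℝ, S₁.PosSemidef →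
      ‖A₁ - A‖ ≤ η → ‖R₁ - R‖ ≤ η → ‖S₁ - S‖ ≤ η → RiccatiDrift A₁ R₁ S₁ V 1 c := by
  obtain ⟨k, hk, htr⟩ := hV.exists_trace_le
  have hVt := hV.posSemidef.trace_nonneg
  have hWt := hV.inv.posSemidef.trace_nonneg
  refine ⟨(1 / 4) * ((‖S‖ + 1) * V⁻¹.trace) + (‖R‖ + 1) * V.trace,
    -- The second entry makes the perturbation cost at most `tr(V X)`, one of the two units of decay
    -- available; the cap `1` bounds `‖R₁‖` and `‖S₁‖` in `c`.
    min 1 (1 / ((2 * ‖V‖ + 1) * k)), by positivity, by positivity,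
    fun A₁ R₁ S₁ hS₁ hA hR hS X hX => ?_⟩
  have hη : min 1 (1 / ((2 * ‖V‖ + 1) * k)) * ((2 * ‖V‖ + 1) * k) ≤ 1 := by
    rw [← le_div_iff₀ (by positivity)]
    exact min_le_right _ _
  set η := min 1 (1 / ((2 * ‖V‖ + 1) * k))
  have hη1 : η ≤ 1 := min_le_left _ _
  refine (trace_mul_ricc_le hV hS₁ hX).trans ?_
  have h1 : (S₁ * V⁻¹).trace ≤ (‖S‖ + 1) * V⁻¹.trace := by
    refine (le_abs_self _).trans ((hV.inv.posSemidef.abs_trace_mul_le S₁).trans ?_)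
    gcongr
    linarith [norm_sub_norm_le S₁ S]
  have h2 : (R₁ * V).trace ≤ (‖R‖ + 1) * V.trace := by
    refine (le_abs_self _).trans ((hV.posSemidef.abs_trace_mul_le R₁).trans ?_)
    gcongr
    linarith [norm_sub_norm_le R₁ R]
  have h3 := hlyap.trace_mul_nonneg hX
  have h4 : (((A₁ - A)ᵀ * V + V * (A₁ - A) - (S₁ - S)) * X).trace ≤ (V * X).trace := by
    refine (le_abs_self _).trans ((hX.abs_trace_mul_le _).trans ?_)
    have h5 : ‖(A₁ - A)ᵀ * V + V * (A₁ - A) - (S₁ - S)‖ ≤ η * (2 * ‖V‖ + 1) := by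
      calc _ ≤ ‖(A₁ - A)ᵀ‖ * ‖V‖ + ‖V‖ * ‖A₁ - A‖ + ‖S₁ - S‖ :=
            (norm_sub_le _ _).trans (add_le_add ((norm_add_le _ _).trans
              (add_le_add (norm_mul_le _ _) (norm_mul_le _ _))) le_rfl)
        _ ≤ η * ‖V‖ + ‖V‖ * η + η := by rw [l2_opNorm_transpose]; gcongr
        _ = _ := by ring
    have hη0 : 0 ≤ η := (norm_nonneg _).trans hA
    calc _ ≤ η * (2 * ‖V‖ + 1) * (k * (V * X).trace) :=
          mul_le_mul h5 (htr X hX) hX.trace_nonneg (by positivity)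
      _ = (η * ((2 * ‖V‖ + 1) * k)) * (V * X).trace := by ring
      _ ≤ _ := mul_le_of_le_one_left (hV.posSemidef.trace_mul_nonneg hX) hη
  simp only [Matrix.transpose_sub, sub_mul, mul_sub, add_mul, Matrix.trace_sub, Matrix.trace_add,
    Matrix.trace_smul, smul_mul_assoc, smul_eq_mul] at h3 h4 ⊢
  linarith

end Observability

/-! ### Size of the perturbations and the sandwich for the `π`-drift. -/

section Continuity

variable {r : ℕ} {A R S : Matrix (Fin r) (Fin r) ℝ}

/-- Split `Y - X = (Y - αX) - (1 - α)X`; the first term lies between `0` and `(α⁻¹ - α)X`, and `1 -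
α ≤ α⁻¹ - α`. -/
lemma norm_sub_le_of_loewner {X Y : Matrix (Fin r) (Fin r) ℝ} {α : ℝ}
    (hα : 0 < α) (hα1 : α < 1) (h1 : (Y - α • X).PosSemidef) (h2 : (α⁻¹ • X - Y).PosSemidef) :
    ‖Y - X‖ ≤ 2 * (α⁻¹ - α) * ‖X‖ := by
  have hinv : 1 < α⁻¹ := (one_lt_inv₀ hα).2 hα1
  have h3 : ‖Y - α • X‖ ≤ (α⁻¹ - α) * ‖X‖ := by
    refine (h1.l2_opNorm_le_of_le (Y := (α⁻¹ - α) • X) ?_).trans_eq ?_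
    · convert h2 using 1
      rw [sub_smul]; abel
    · rw [norm_smul, Real.norm_of_nonneg (by linarith)]
  have h4 : ‖(1 - α) • X‖ = (1 - α) * ‖X‖ := by
    rw [norm_smul, Real.norm_of_nonneg (by linarith)]
  have h5 : Y - X = (Y - α • X) - (1 - α) • X := by rw [sub_smul, one_smul]; abel
  rw [h5]
  refine (norm_sub_le _ _).trans ?_
  rw [h4]
  nlinarith [norm_nonneg X]

lemma exists_loewner_factor {M η : ℝ} (hM : 0 ≤ M) (hη : 0 < η) :
    ∃ α : ℝ, 0 < α ∧ α < 1 ∧ 2 * (α⁻¹ - α) * M ≤ η := by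
  -- With `α = 1 - θ` and `θ ≤ 1/2` one has `α⁻¹ - α ≤ 3θ`, whence the factor `6`.
  set θ : ℝ := min (1 / 2) (η / (6 * (M + 1))) with hθ
  have h0 : 0 < θ := by positivity
  have h1 : θ ≤ 1 / 2 := min_le_left _ _
  have h2 : θ * (6 * (M + 1)) ≤ η := by
    rw [← le_div_iff₀ (by positivity)]; exact min_le_right _ _
  refine ⟨1 - θ, by linarith, by linarith, ?_⟩
  have h3 : (1 - θ)⁻¹ ≤ 1 + 2 * θ := by
    rw [inv_le_iff_one_le_mul₀ (by linarith)]; nlinarith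
  have h4 : 2 * ((1 - θ)⁻¹ - (1 - θ)) * M ≤ 2 * (3 * θ) * M := by
    gcongr; linarith
  nlinarith

lemma ContinuityCondition.exists_delta {M : Set C(PSDMat r, PSDMat r)}
    {Ap Rp Sp : C(PSDMat r, PSDMat r) → Matrix (Fin r) (Fin r) ℝ}
    (h : ContinuityCondition A R S M Ap Rp Sp) (hR : R.PosDef) (hS : S.PosSemidef) {η : ℝ}
    (hη : 0 < η) :
    ∃ δ : ℝ, 0 < δ ∧ ∀ π ∈ idBall M δ, (Rp π).PosDef ∧ (Sp π).PosSemidef ∧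
      ‖Ap π - A‖ ≤ η ∧ ‖Rp π - R‖ ≤ η ∧ ‖Sp π - S‖ ≤ η := by
  obtain ⟨α, hα, hα1, hαη⟩ := exists_loewner_factor (add_nonneg (norm_nonneg R) (norm_nonneg S)) hη
  obtain ⟨δ, hδ, hball⟩ := h (min η 1) α (by positivity) (min_le_right _ _) hα hα1
  refine ⟨δ, hδ, fun π hπ => ?_⟩
  obtain ⟨h1, h2, h3, h4, h5⟩ := hball π hπ
  have hα2 : 0 ≤ 2 * (α⁻¹ - α) := by
    have : 1 < α⁻¹ := (one_lt_inv₀ hα).2 hα1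
    linarith
  refine ⟨?_, ?_, ?_, ?_, ?_⟩
  · simpa using Matrix.PosDef.posSemidef_add h3 (hR.smul hα)
  · simpa using h1.add (hS.smul hα.le)
  · rw [norm_sub_rev]; exact h5.trans (min_le_left _ _)
  · refine (norm_sub_le_of_loewner hα hα1 h3 h4).trans (le_trans ?_ hαη)
    gcongr
    linarith [norm_nonneg S]
  · refine (norm_sub_le_of_loewner hα hα1 h1 h2).trans (le_trans ?_ hαη)
    gcongr
    linarith [norm_nonneg R]

lemma norm_ricc_sub_ricc_le (A R S A₁ R₁ S₁ X : Matrix (Fin r) (Fin r) ℝ) :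
    ‖ricc A₁ R₁ S₁ X - ricc A R S X‖ ≤ gammaDist A R S A₁ R₁ S₁ * (1 + ‖X‖) ^ 2 := by
  have e : ricc A₁ R₁ S₁ X - ricc A R S X =
      (A₁ - A) * X + X * (A₁ - A)ᵀ - X * (S₁ - S) * X + (R₁ - R) := by
    simp only [ricc, Matrix.transpose_sub]
    noncomm_ring
  rw [e, gammaDist]
  have h1 : ‖(A₁ - A) * X‖ ≤ ‖A₁ - A‖ * ‖X‖ := norm_mul_le _ _
  have h2 : ‖X * (A₁ - A)ᵀ‖ ≤ ‖X‖ * ‖A₁ - A‖ :=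
    (norm_mul_le _ _).trans_eq (by rw [l2_opNorm_transpose])
  have h3 : ‖X * (S₁ - S) * X‖ ≤ ‖X‖ * ‖S₁ - S‖ * ‖X‖ :=
    (norm_mul_le _ _).trans (mul_le_mul_of_nonneg_right (norm_mul_le _ _) (norm_nonneg _))
  have h4 : ‖(A₁ - A) * X + X * (A₁ - A)ᵀ - X * (S₁ - S) * X + (R₁ - R)‖ ≤
      ‖(A₁ - A) * X‖ + ‖X * (A₁ - A)ᵀ‖ + ‖X * (S₁ - S) * X‖ + ‖R₁ - R‖ :=
    (norm_add_le _ _).trans (add_le_add ((norm_sub_le _ _).trans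
      (add_le_add (norm_add_le _ _) le_rfl)) le_rfl)
  have hx := norm_nonneg X
  have ha := norm_nonneg (A₁ - A)
  have hr := norm_nonneg (R₁ - R)
  have hs := norm_nonneg (S₁ - S)
  have p1 := mul_nonneg hs hx
  have p2 := mul_nonneg hr hx
  have p3 := mul_nonneg hr (sq_nonneg ‖X‖)
  have p4 := mul_nonneg ha (sq_nonneg ‖X‖)
  nlinarith

lemma gammaDist_nonneg (A R S A₁ R₁ S₁ : Matrix (Fin r) (Fin r) ℝ) :
    0 ≤ gammaDist A R S A₁ R₁ S₁ := by
  unfold gammaDist; positivity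

/-- Completing the square: the excess is semi-definite when `S` is, so a Loewner upper bound on it
also bounds its norm. -/
lemma riccMap_sub_ricc (hS : Sᵀ = S) (π : PSDMat r → PSDMat r) (Q : PSDMat r) :
    riccMap A R S π Q - ricc A R S Q.1 = ((π Q).1 - Q.1)ᵀ * S * ((π Q).1 - Q.1) := by
  simp only [riccMap, ricc, Matrix.transpose_sub, Matrix.transpose_mul, hS, (π Q).2.isSymm,
    Q.2.isSymm]
  noncomm_ring

/-- Under the structural condition, the `π`-perturbed drift is sandwiched between the nominal drift
and the drift of the perturbed model. -/
lemma QuadraticPerturbation.posSemidef_sub {π : PSDMat r → PSDMat r}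
    {A₁ R₁ S₁ : Matrix (Fin r) (Fin r) ℝ} (h : QuadraticPerturbation A R S π A₁ R₁ S₁)
    (Q : PSDMat r) : (ricc A₁ R₁ S₁ Q.1 - riccMap A R S π Q).PosSemidef := by
  obtain ⟨B₀, B₁, B₂, Rem, ϖ, -, -, -, -, hsymm, hϖ, heq, rfl, rfl, rfl⟩ := h
  have e : ricc (A + B₁) (R + B₀ + ϖ • (1 : Matrix (Fin r) (Fin r) ℝ)) (S - B₂) Q.1 -
      riccMap A R S π Q = ϖ • (1 : Matrix (Fin r) (Fin r) ℝ) - Rem Q := by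
    rw [heq]
    simp only [ricc, Matrix.transpose_add]
    noncomm_ring
  rw [e]
  refine posSemidef_of_isSymm ?_ fun x => ?_
  · rw [Matrix.IsSymm, Matrix.transpose_sub, Matrix.transpose_smul, Matrix.transpose_one,
      (hsymm Q).eq]
  · have h1 := (le_abs_self _).trans (abs_dotProduct_mulVec_le (Rem Q) x)
    have h2 : ‖Rem Q‖ ≤ ϖ := hϖ.1 ⟨Q, rfl⟩
    have h3 : 0 ≤ x ⬝ᵥ x := dotProduct_self_star_nonneg x
    rw [Matrix.sub_mulVec, Matrix.smul_mulVec, Matrix.one_mulVec, dotProduct_sub, dotProduct_smul,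
      smul_eq_mul]
    nlinarith

end Continuity

/-! ### Assembly of the theorem. -/

theorem theorem2p6 {r m : ℕ} (A R S : Matrix (Fin r) (Fin r) ℝ)
    (C : Matrix (Fin m) (Fin r) ℝ) (Sig : Matrix (Fin m) (Fin m) ℝ)
    (hR : R.PosDef) (hSig : Sig.PosDef) (hS : S = Cᵀ * Sig⁻¹ * C)
    (hobs : IsObservablePair A C) :
    RiccatiWellPosed (fun X : PSDMat r => ricc A R S X.1) ∧
    (∃! P : Matrix (Fin r) (Fin r) ℝ, IsRiccatiFixedPoint A R S P) ∧
    (∃ ν : ℝ, IsContractionRate A R S ν) ∧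
    ∀ ν : ℝ, IsContractionRate A R S ν →
      ∃ (χ₁ : ℝ → ℝ) (χ₂ : ℝ → ℝ → ℝ),
        ∀ (M : Set C(PSDMat r, PSDMat r))
          (Ap Rp Sp : C(PSDMat r, PSDMat r) → Matrix (Fin r) (Fin r) ℝ),
          ContinuityCondition A R S M Ap Rp Sp →
          ∃ δ : ℝ, 0 < δ ∧ ∀ π ∈ idBall M δ,
            RiccatiWellPosed (fun X : PSDMat r => ricc (Ap π) (Rp π) (Sp π) X.1) ∧
            (∀ (t : ℝ) (Q : PSDMat r), 0 ≤ t →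
              ‖(phi (Ap π) (Rp π) (Sp π) t Q).1 - (phi A R S t Q).1‖ ≤
                (χ₁ δ + Real.exp (-4 * t * ν) * χ₂ δ ‖Q.1‖) *
                  gammaDist A R S (Ap π) (Rp π) (Sp π)) ∧
            (∃! Pp : Matrix (Fin r) (Fin r) ℝ,
              IsRiccatiFixedPoint (Ap π) (Rp π) (Sp π) Pp) ∧
            (∀ P Pp : Matrix (Fin r) (Fin r) ℝ, IsRiccatiFixedPoint A R S P →
              IsRiccatiFixedPoint (Ap π) (Rp π) (Sp π) Pp →
              ‖Pp - P‖ ≤ χ₁ δ * gammaDist A R S (Ap π) (Rp π) (Sp π)) ∧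
            (QuadraticPerturbation A R S π (Ap π) (Rp π) (Sp π) →
              ∀ (Q : PSDMat r) (p : ℝ → PSDMat r),
                IsRiccatiSolution (riccMap A R S π) Q p → ∀ t : ℝ, 0 ≤ t →
                  ‖(p t).1 - (phi A R S t Q).1‖ ≤
                    (χ₁ δ + Real.exp (-4 * t * ν) * χ₂ δ ‖Q.1‖) *
                      gammaDist A R S (Ap π) (Rp π) (Sp π)) := by
  have hSpsd : S.PosSemidef := by
    rw [hS, ← Matrix.conjTranspose_eq_transpose_of_trivial]
    exact hSig.inv.posSemidef.conjTranspose_mul_mul_same C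
  obtain ⟨V, hV, hlyap⟩ := exists_lyapunov hSig hS hobs
  obtain ⟨c, η, hc, hη, hdrift⟩ := exists_uniform_riccatiDrift (R := R) hV hlyap
  -- The nominal model is its own neighbour, so it shares `V` and `c` with the perturbed ones.
  have hd : RiccatiDrift A R S V 1 c :=
    hdrift A R S hSpsd (by simpa using hη.le) (by simpa using hη.le) (by simpa using hη.le)
  have hrate := exists_isContractionRate hR hSpsd hV one_pos hc hd
  refine ⟨riccatiWellPosed hR hSpsd, ?_, hrate, fun ν hν => ?_⟩
  · obtain ⟨ν, hν⟩ := hrate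
    exact existsUnique_isRiccatiFixedPoint hR hSpsd hν
  obtain ⟨χ₁, χ₂, hbound⟩ := hν.exists_perturbation_bound hR hSpsd hV one_pos hc hd
  refine ⟨fun _ => χ₁, fun _ => χ₂, fun M Ap Rp Sp hcont => ?_⟩
  obtain ⟨δ, hδ, hball⟩ := hcont.exists_delta hR hSpsd hη
  refine ⟨δ, hδ, fun π hπ => ?_⟩
  obtain ⟨hR₁, hS₁, hA', hR', hS'⟩ := hball π hπ
  have hd₁ := hdrift _ _ _ hS₁ hA' hR' hS'
  -- This rate serves only the existence and uniqueness of `P_π`; the estimates use `ν`.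
  obtain ⟨ν₁, hν₁⟩ := exists_isContractionRate hR₁ hS₁ hV one_pos hc hd₁
  have hγ := gammaDist_nonneg A R S (Ap π) (Rp π) (Sp π)
  have hflow : ∀ (t : ℝ) (Q : PSDMat r), 0 ≤ t →
      ‖(phi (Ap π) (Rp π) (Sp π) t Q).1 - (phi A R S t Q).1‖ ≤
        (χ₁ + Real.exp (-4 * t * ν) * χ₂ ‖Q.1‖) * gammaDist A R S (Ap π) (Rp π) (Sp π) := by
    intro t Q ht
    have := hbound _ (fun t => phi (Ap π) (Rp π) (Sp π) t Q)
      (fun t => ricc (Ap π) (Rp π) (Sp π) (phi (Ap π) (Rp π) (Sp π) t Q).1 -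
        ricc A R S (phi (Ap π) (Rp π) (Sp π) t Q).1) hγ
      (fun t ht => by
        rw [add_sub_cancel]; exact (isRiccatiSolution_phi hR₁ hS₁ Q).2 t ht)
      (fun t _ => by rw [add_sub_cancel]; exact hd₁ _ (phi (Ap π) (Rp π) (Sp π) t Q).2)
      (fun t _ => norm_ricc_sub_ricc_le _ _ _ _ _ _ _) t ht
    simpa only [phi_zero hR₁ hS₁] using this
  refine ⟨riccatiWellPosed hR₁ hS₁, hflow, existsUnique_isRiccatiFixedPoint hR₁ hS₁ hν₁,
    fun P P₁ hP hP₁ => ?_, fun hquad Q p hp t ht => ?_⟩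
  · obtain ⟨κ, -, -, hlip⟩ := hν.exists_lipschitz hR hSpsd
    -- Started at `P_π`, the perturbed flow stands still while the nominal one tends to `P`; only
    -- the `χ₁` term survives as `t → ∞`.
    refine le_of_le_add_mul_exp (C := χ₂ ‖P₁‖ * gammaDist A R S (Ap π) (Rp π) (Sp π) +
      κ ‖P₁‖ * κ ‖P‖ * ‖P₁ - P‖) hν.1 fun t ht => ?_
    have h1 := hflow t ⟨P₁, hP₁.1.posSemidef⟩ ht
    have h2 := hlip ⟨P₁, hP₁.1.posSemidef⟩ ⟨P, hP.1.posSemidef⟩ t ht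
    rw [hP₁.phi_eq hR₁ hS₁ ht] at h1
    rw [hP.phi_eq hR hSpsd ht] at h2
    have h3 := norm_sub_le_norm_sub_add_norm_sub P₁ (phi A R S t ⟨P₁, hP₁.1.posSemidef⟩).1 P
    have e : Real.exp (-4 * t * ν) = Real.exp (-4 * ν * t) := by ring_nf
    rw [e] at h1
    simp only at h1 h2 h3 ⊢
    linarith
  -- Both hypotheses on the trajectory follow from the sandwich: the trace against `V` is monotone,
  -- and so is the norm on the cone. No comparison of flows is needed.
  · have hle := hquad.posSemidef_sub
    have := hbound _ p (fun t => riccMap A R S π (p t) - ricc A R S (p t).1) hγ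
      (fun t ht => by rw [add_sub_cancel]; exact hp.2 t ht)
      (fun t _ => by
        rw [add_sub_cancel]
        have h1 := hV.posSemidef.trace_mul_nonneg (hle (p t))
        have h2 := hd₁ _ (p t).2
        rw [Matrix.mul_sub, Matrix.trace_sub] at h1
        linarith)
      (fun t _ => by
        refine le_trans ?_ (norm_ricc_sub_ricc_le A R S (Ap π) (Rp π) (Sp π) (p t).1)
        refine Matrix.PosSemidef.l2_opNorm_le_of_le ?_ ?_
        · rw [riccMap_sub_ricc hSpsd.isSymm]
          exact hSpsd.transpose_mul_mul _
        · simpa using hle (p t)) t ht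
    rwa [hp.1] at this
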